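/- Let $X$ be a metric space and $A$ an abelian group. **The site $X_{ct}$.** An entourage is a set $E$ of pairs of points with $\sup_{(x,y)\in E}d(x,y)<\infty$; for a set $B$ write $E[B]=\{x\mid (x,y)\in E \text{ for some } y\in B\}$. A finite (possibly empty) family $U_1,\dots,U_n$ of subsets of $U\subseteq X$ is a *coarse cover* of $U$ if for every entourage $E\subseteq U\times U$ the set $U\cap\bigcap_{i=1}^n E[U\setminus U_i]$ is bounded. The site $X_{ct}$ is the poset of all subsets of $X$ with the coarse covers as coverings. The constant sheaf $A_X$ is the sheafification on $X_{ct}$ of the constant presheaf $A$; coarse sheaf cohomology $\check H^q_{ct}(X;-)$ is the $q$-th right derived functor of the global sections functor $\mathcal F\mapsto\mathcal F(X)$ on sheaves of abelian groups on $X_{ct}$. A sheaf on $X_{ct}$ is *flabby* if $\mathcal F(V)\to\mathcal F(U)$ is surjective for all $U\subseteq V\subseteq X$. **Cochains.** For $U\subseteq X$ and $q\ge 0$ a function $\varphi:U^{q+1}\to A$ is *blocky* if there is a finite partition $U=A_1\sqcup\dots\sqcup A_n$ such that $\varphi$ is constant on $A_{i_0}\times\dots\times A_{i_q}$ for all $i_0,\dots,i_q\in\{1,\dots,n\}$.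 A set $C\subseteq U^{q+1}$ is *cocontrolled* if for every $R\ge 0$ the set of all $(x_0,\dots,x_q)\in C$ with $d(x_i,x_j)\le R$ for all $i,j$ has bounded projection to every factor. Let $CY^q_b(U,A)$ be the group of blocky functions $U^{q+1}\to A$ modulo the subgroup of blocky functions with cocontrolled support. The differential $d_q:CY^q_b(U,A)\to CY^{q+1}_b(U,A)$ is induced by $(d_q\varphi)(x_0,\dots,x_{q+1})=\sum_{i=0}^{q+1}(-1)^i\varphi(x_0,\dots,\hat x_i,\dots,x_{q+1})$, and $HY^q_b(X,A)$ denotes the $q$-th cohomology group of the complex $(CY^*_b(X,A),d_*)$. Restriction of functions makes $U\mapsto CY^q_b(U,A)$ a presheaf on the subsets of $X$. **Theorem.** For every $q\ge 0$ the presheaf $CY^q_b(\cdot,A):U\mapsto CY^q_b(U,A)$ is a flabby sheaf on $X_{ct}$, and the sequence of sheaves of abelian groups on $X_{ct}$ $$0\to A_X\to CY^0_b(\cdot,A)\xrightarrow{d_0}CY^1_b(\cdot,A)\xrightarrow{d_1}CY^2_b(\cdot,A)\to\cdots$$ is exact, where $A_X\to CY^0_b(\cdot,A)$ is induced by sending $a\in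 A$ to the class of the constant function $a$. Consequently, for every $q\ge 0$ there is an isomorphism of abelian groups $$\check H^q_{ct}(X;A_X)\cong HY^q_b(X,A).$$ -/

import Mathlib

open CategoryTheory

universe u v

namespace Coarse

/-! ### The coarse Grothendieck topology -/

section Topology

variable {X : Type u} [MetricSpace X]

/-- A set of pairs is an entourage if its members have uniformly bounded distance. -/
def IsEntourage (E : Set (X × X)) : Prop :=
  ∃ R : ℝ, ∀ p ∈ E, dist p.1 p.2 ≤ R

/-- `E[B] = {x | (x, y) ∈ E for some y ∈ B}`. -/
def entourageImage (E : Set (X × X)) (B : Set X) : Set X :=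
  {x | ∃ y ∈ B, (x, y) ∈ E}

/-- A family `V` of subsets of `U` (used for finite families only, the empty family included) is a
coarse cover of `U` if for every entourage `E ⊆ U × U` the intersection over `i` of the sets
`E[U \ V i]`, taken inside `U`, is bounded. -/
structure IsCoarseCover {ι : Type} (U : Set X) (V : ι → Set X) : Prop where
  subset : ∀ i, V i ⊆ U
  isBounded : ∀ E : Set (X × X), E ⊆ U ×ˢ U → IsEntourage E →
    Bornology.IsBounded (U ∩ ⋂ i, entourageImage E (U \ V i))

lemma isCoarseCover_self (U : Set X) : IsCoarseCover U (fun _ : Unit => U) where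
  subset _ := subset_rfl
  isBounded E _ _ := by
    have h : (U ∩ ⋂ _ : Unit, entourageImage E (U \ U)) = ∅ := by
      ext x
      simp [entourageImage]
    rw [h]
    exact Bornology.isBounded_empty

lemma IsCoarseCover.inter {ι : Type} {U : Set X} {V : ι → Set X} (h : IsCoarseCover U V)
    {W : Set X} (hW : W ⊆ U) : IsCoarseCover W (fun i => V i ∩ W) where
  subset _ := Set.inter_subset_right
  isBounded E hE hE' := by
    refine (h.isBounded E (hE.trans (Set.prod_mono hW hW)) hE').subset ?_
    rintro x ⟨hx, hx'⟩
    refine ⟨hW hx, Set.mem_iInter.2 fun i => ?_⟩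
    obtain ⟨y, hy, hxy⟩ := Set.mem_iInter.1 hx' i
    exact ⟨y, ⟨hW hy.1, fun hyV => hy.2 ⟨hyV, hy.1⟩⟩, hxy⟩

lemma IsCoarseCover.sigma {ι : Type} [Finite ι] {κ : ι → Type} {U : Set X} {V : ι → Set X}
    (h : IsCoarseCover U V) {W : ∀ i, κ i → Set X} (hW : ∀ i, IsCoarseCover (V i) (W i)) :
    IsCoarseCover U (fun p : Σ i, κ i => W p.1 p.2) where
  subset p := ((hW p.1).subset p.2).trans (h.subset p.1)
  isBounded E hE := by
    rintro ⟨R, hR⟩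
    have hent : ∀ (S : ℝ) (T : Set X), IsEntourage {p ∈ T ×ˢ T | dist p.1 p.2 ≤ S} :=
      fun S T => ⟨S, fun p hp => hp.2⟩
    have h0 := h.isBounded {p ∈ U ×ˢ U | dist p.1 p.2 ≤ max R 0} (fun p hp => hp.1) (hent _ _)
    have h1 := fun i => (hW i).isBounded {p ∈ V i ×ˢ V i | dist p.1 p.2 ≤ 2 * max R 0}
      (fun p hp => hp.1) (hent _ _)
    refine (h0.union (Bornology.isBounded_iUnion.2
      fun i => (h1 i).cthickening (δ := max R 0))).subset ?_
    rintro x ⟨hxU, hx⟩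
    have key : ∀ p : Σ i, κ i, ∃ y ∈ U, y ∉ W p.1 p.2 ∧ dist x y ≤ max R 0 := fun p => by
      obtain ⟨y, hy, hxy⟩ := Set.mem_iInter.1 hx p
      exact ⟨y, hy.1, hy.2, (hR _ hxy).trans (le_max_left _ _)⟩
    by_cases hall : ∀ i, ∃ y ∈ U \ V i, dist x y ≤ max R 0
    · left
      refine ⟨hxU, Set.mem_iInter.2 fun i => ?_⟩
      obtain ⟨y, hy, hxy⟩ := hall i
      exact ⟨y, hy, ⟨hxU, hy.1⟩, hxy⟩
    · right
      push Not at hall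
      obtain ⟨i, hi⟩ := hall
      have hin : ∀ y ∈ U, dist x y ≤ max R 0 → y ∈ V i := fun y hy hxy => by
        by_contra hyV
        exact absurd hxy (not_le.2 (hi y ⟨hy, hyV⟩))
      have hxV : x ∈ V i := hin x hxU (by simp)
      refine Set.mem_iUnion.2 ⟨i, Metric.self_subset_cthickening _ ⟨hxV, Set.mem_iInter.2 ?_⟩⟩
      intro k
      obtain ⟨y, hyU, hyW, hxy⟩ := key ⟨i, k⟩
      have hyV := hin y hyU hxy
      refine ⟨y, ⟨hyV, hyW⟩, ⟨hxV, hyV⟩, hxy.trans ?_⟩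
      have := le_max_right R 0
      linarith

variable (X) in
/-- The Grothendieck topology `X_ct` on the poset of all subsets of `X`: a sieve on `U` is covering
if and only if it contains (the members of) a finite coarse cover of `U`. -/
def coarseTopology : GrothendieckTopology (Set X) where
  sieves U := {S | ∃ (ι : Type) (_ : Finite ι) (V : ι → Set X) (hV : IsCoarseCover U V),
    ∀ i, S (homOfLE (hV.subset i))}
  top_mem' U := ⟨Unit, inferInstance, _, isCoarseCover_self U, fun _ => trivial⟩
  pullback_stable' U W S f := by
    rintro ⟨ι, hι, V, hV, hS⟩
    refine ⟨ι, hι, _, hV.inter (leOfHom f), fun i => ?_⟩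
    exact S.downward_closed (hS i) (homOfLE Set.inter_subset_left)
  transitive' U S := by
    rintro ⟨ι, hι, V, hV, hS⟩ T hT
    choose κ hκ W hW hW' using fun i => hT (hS i)
    exact ⟨Σ i, κ i, inferInstance, _, hV.sigma hW, fun p => hW' p.1 p.2⟩

end Topology

/-! ### Blocky cochains modulo blocky cochains with cocontrolled support -/

section Cochains

set_option linter.unusedSectionVars false

variable (Y : Type u) [MetricSpace Y] (A : Type v) [AddCommGroup A]

variable {Y} in
/-- A set `C` of `(q + 1)`-tuples is cocontrolled if for every `R ≥ 0` each coordinate projection of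
`{x ∈ C | d (x i) (x j) ≤ R for all i, j}` is bounded. -/
def IsCocontrolled {q : ℕ} (C : Set (Fin (q + 1) → Y)) : Prop :=
  ∀ R : ℝ, 0 ≤ R → ∀ k : Fin (q + 1),
    Bornology.IsBounded ((fun x => x k) '' (C ∩ {x | ∀ i j, dist (x i) (x j) ≤ R}))

variable {Y A} in
/-- A function of `q + 1` variables is blocky if `Y` is the disjoint union of finitely many blocks
(the fibres of `p`) such that the function is constant on every product of `q + 1` blocks. -/
def IsBlocky {q : ℕ} (φ : (Fin (q + 1) → Y) → A) : Prop :=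
  ∃ (n : ℕ) (p : Y → Fin n), ∀ x y : Fin (q + 1) → Y, (∀ i, p (x i) = p (y i)) → φ x = φ y

variable {Y A} in
lemma IsBlocky.add {q : ℕ} {φ ψ : (Fin (q + 1) → Y) → A} (hφ : IsBlocky φ) (hψ : IsBlocky ψ) :
    IsBlocky (φ + ψ) := by
  obtain ⟨n, p, hp⟩ := hφ
  obtain ⟨m, r, hr⟩ := hψ
  refine ⟨n * m, fun x => finProdFinEquiv (p x, r x), fun x y h => ?_⟩
  have h' : ∀ i, p (x i) = p (y i) ∧ r (x i) = r (y i) := fun i => by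
    simpa using h i
  simp [hp x y fun i => (h' i).1, hr x y fun i => (h' i).2]

/-- The group of blocky functions `Y^(q+1) → A` (two representatives in the direct limit over all
finite partitions are identified exactly if they are equal as functions). -/
def blocky (q : ℕ) : AddSubgroup ((Fin (q + 1) → Y) → A) where
  carrier := {φ | IsBlocky φ}
  add_mem' := IsBlocky.add
  zero_mem' := ⟨1, fun _ => 0, fun _ _ _ => rfl⟩
  neg_mem' := by
    rintro φ ⟨n, p, hp⟩
    exact ⟨n, p, fun x y h => by simp [hp x y h]⟩

variable {Y} in
lemma IsCocontrolled.mono {q : ℕ} {C D : Set (Fin (q + 1) → Y)} (hD : IsCocontrolled D)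
    (h : C ⊆ D) : IsCocontrolled C := fun R hR k =>
  (hD R hR k).subset (Set.image_mono (Set.inter_subset_inter_left _ h))

variable {Y} in
lemma IsCocontrolled.union {q : ℕ} {C D : Set (Fin (q + 1) → Y)} (hC : IsCocontrolled C)
    (hD : IsCocontrolled D) : IsCocontrolled (C ∪ D) := fun R hR k => by
  rw [Set.union_inter_distrib_right, Set.image_union]
  exact (hC R hR k).union (hD R hR k)

/-- The subgroup of functions `Y^(q+1) → A` with cocontrolled support. -/
def cocontrolledFunctions (q : ℕ) : AddSubgroup ((Fin (q + 1) → Y) → A) where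
  carrier := {φ | IsCocontrolled (Function.support φ)}
  add_mem' hφ hψ := (IsCocontrolled.union hφ hψ).mono (Function.support_add _ _)
  zero_mem' := fun R _ k => by simp
  neg_mem' := by
    intro φ hφ
    simpa [Function.support_neg] using hφ

/-- `CX_b^q(Y, A)`: blocky functions with cocontrolled support, as a subgroup of all blocky
functions. -/
def CX (q : ℕ) : AddSubgroup (blocky Y A q) :=
  (cocontrolledFunctions Y A q).addSubgroupOf (blocky Y A q)

/-- `CY_b^q(Y, A)`: blocky functions modulo blocky functions with cocontrolled support. -/
abbrev CY (q : ℕ) : Type (max u v) :=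
  blocky Y A q ⧸ CX Y A q

/-- The coboundary on functions,
`(δ φ)(x_0, …, x_{q+1}) = ∑ i, (-1)^i φ(x_0, …, x_i omitted, …, x_{q+1})`. -/
def coboundary (q : ℕ) : ((Fin (q + 1) → Y) → A) →+ ((Fin (q + 2) → Y) → A) where
  toFun φ x := ∑ i : Fin (q + 2), (-1 : ℤ) ^ (i : ℕ) • φ (fun j => x (i.succAbove j))
  map_zero' := by
    ext x
    simp
  map_add' φ ψ := by
    ext x
    simp [Finset.sum_add_distrib]

lemma coboundary_apply (q : ℕ) (φ : (Fin (q + 1) → Y) → A) (x : Fin (q + 2) → Y) :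
    coboundary Y A q φ x =
      ∑ i : Fin (q + 2), (-1 : ℤ) ^ (i : ℕ) • φ (fun j => x (i.succAbove j)) := rfl

lemma coboundary_coboundary (q : ℕ) (φ : (Fin (q + 1) → Y) → A) :
    coboundary Y A (q + 1) (coboundary Y A q φ) = 0 := by
  ext x
  simp only [coboundary_apply, Finset.smul_sum, smul_smul, ← pow_add, Pi.zero_apply]
  rw [← Finset.sum_product']
  refine Finset.sum_involution (fun p _ => (p.1.succAbove p.2, p.2.predAbove p.1)) ?_ ?_ ?_ ?_
  · rintro ⟨i, j⟩ -
    simp only [Fin.succAbove_succAbove_succAbove_predAbove, Fin.neg_one_pow_succAbove_add_predAbove]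
    rw [← add_smul, add_neg_cancel, zero_smul]
  · rintro ⟨i, j⟩ - - h
    exact Fin.succAbove_ne _ _ (congrArg Prod.fst h)
  · simp
  · rintro ⟨i, j⟩ -
    simp [Fin.succAbove_succAbove_predAbove, Fin.predAbove_predAbove_succAbove]

lemma coboundary_mem_blocky (q : ℕ) {φ : (Fin (q + 1) → Y) → A} (hφ : φ ∈ blocky Y A q) :
    coboundary Y A q φ ∈ blocky Y A (q + 1) := by
  obtain ⟨n, p, hp⟩ := hφ
  refine ⟨n, p, fun x y h => ?_⟩
  simp only [coboundary_apply]
  exact Finset.sum_congr rfl fun i _ => by rw [hp _ _ fun j => h (i.succAbove j)]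

lemma coboundary_mem_cocontrolled (q : ℕ) {φ : (Fin (q + 1) → Y) → A}
    (hφ : φ ∈ cocontrolledFunctions Y A q) :
    coboundary Y A q φ ∈ cocontrolledFunctions Y A (q + 1) := by
  intro R hR k
  have hb : Bornology.IsBounded (⋃ j, (fun x => x j) ''
      (Function.support φ ∩ {x | ∀ i j, dist (x i) (x j) ≤ R})) :=
    Bornology.isBounded_iUnion.2 fun j => hφ R hR j
  refine (hb.cthickening (δ := R)).subset ?_
  rintro _ ⟨x, ⟨hx, hxR⟩, rfl⟩
  have hx' := Function.mem_support.1 hx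
  rw [coboundary_apply] at hx'
  obtain ⟨i, -, hi⟩ := Finset.exists_ne_zero_of_sum_ne_zero hx'
  have hi' : φ (fun j => x (i.succAbove j)) ≠ 0 := fun h => hi (by rw [h, smul_zero])
  refine Metric.mem_cthickening_of_dist_le _ (x (i.succAbove 0)) _ _ ?_ (hxR _ _)
  exact Set.mem_iUnion.2 ⟨0, fun j => x (i.succAbove j), ⟨hi', fun a b => hxR _ _⟩, rfl⟩

/-- The coboundary on blocky functions. -/
def blockyD (q : ℕ) : blocky Y A q →+ blocky Y A (q + 1) :=
  ((coboundary Y A q).comp (blocky Y A q).subtype).codRestrict _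
    fun φ => coboundary_mem_blocky Y A q φ.2

/-- The differential `d_q : CY_b^q(Y, A) → CY_b^(q+1)(Y, A)`. -/
def CY.d (q : ℕ) : CY Y A q →+ CY Y A (q + 1) :=
  QuotientAddGroup.map _ _ (blockyD Y A q) fun _ hφ => coboundary_mem_cocontrolled Y A q hφ

lemma CY.d_d (q : ℕ) (c : CY Y A q) : CY.d Y A (q + 1) (CY.d Y A q c) = 0 := by
  obtain ⟨φ, rfl⟩ := QuotientAddGroup.mk_surjective c
  change QuotientAddGroup.mk (blockyD Y A (q + 1) (blockyD Y A q φ)) = _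
  have : blockyD Y A (q + 1) (blockyD Y A q φ) = 0 :=
    Subtype.ext (coboundary_coboundary Y A q φ)
  rw [this]
  rfl

/-- The cochain complex `(CY_b^q(Y, A), d_q)`. -/
def CYComplex : CochainComplex AddCommGrpCat.{max u v} ℕ :=
  CochainComplex.of (fun q => AddCommGrpCat.of (CY Y A q))
    (fun q => AddCommGrpCat.ofHom (CY.d Y A q)) fun q => by
      ext c
      exact CY.d_d Y A q c

/-- `HY_b^q(Y, A)`, the cohomology of the complex `CY_b^*(Y, A)`. -/
noncomputable def HY (q : ℕ) : AddCommGrpCat.{max u v} :=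
  (CYComplex Y A).homology q

variable {Y} {Z : Type u} [MetricSpace Z]

/-- Pullback of blocky functions along a map. -/
def blockyPullback (f : Z → Y) (q : ℕ) : blocky Y A q →+ blocky Z A q where
  toFun φ := ⟨fun z => φ.1 fun i => f (z i), by
    obtain ⟨n, p, hp⟩ := φ.2
    exact ⟨n, fun z => p (f z), fun x y h => hp _ _ h⟩⟩
  map_zero' := rfl
  map_add' _ _ := rfl

lemma blockyPullback_mem_CX {f : Z → Y} (hf : Isometry f) (q : ℕ) {φ : blocky Y A q}
    (hφ : φ ∈ CX Y A q) : blockyPullback A f q φ ∈ CX Z A q := by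
  intro R hR k
  have h := hf.antilipschitz.isBounded_preimage (hφ R hR k)
  refine h.subset ?_
  rintro _ ⟨z, ⟨hz, hzR⟩, rfl⟩
  exact ⟨fun i => f (z i), ⟨hz, fun i j => (hf.dist_eq _ _).trans_le (hzR i j)⟩, rfl⟩

/-- Pullback `CY_b^q(Y, A) → CY_b^q(Z, A)` along an isometric embedding `Z → Y`. -/
def CY.pullback (f : Z → Y) (hf : Isometry f) (q : ℕ) : CY Y A q →+ CY Z A q :=
  QuotientAddGroup.map _ _ (blockyPullback A f q) fun _ hφ => blockyPullback_mem_CX A hf q hφ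

lemma CY.pullback_d (f : Z → Y) (hf : Isometry f) (q : ℕ) (c : CY Y A q) :
    CY.pullback A f hf (q + 1) (CY.d Y A q c) = CY.d Z A q (CY.pullback A f hf q c) := by
  obtain ⟨φ, rfl⟩ := QuotientAddGroup.mk_surjective c
  rfl

variable {A} in
/-- The class of the constant function with value `a` in `CY_b^0(Y, A)`. -/
def CY.const (Y : Type u) [MetricSpace Y] : A →+ CY Y A 0 :=
  (QuotientAddGroup.mk' (CX Y A 0)).comp
    { toFun a := ⟨fun _ => a, 1, fun _ => 0, fun _ _ _ => rfl⟩
      map_zero' := rfl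
      map_add' _ _ := rfl }

lemma CY.pullback_const (f : Z → Y) (hf : Isometry f) (a : A) :
    CY.pullback A f hf 0 (CY.const Y a) = CY.const Z a := rfl

end Cochains

/-! ### The presheaves `U ↦ CY_b^q(U, A)` -/

section Sheaves

variable (X : Type u) [MetricSpace X] (A : Type u) [AddCommGroup A]

/-- The presheaf `U ↦ CY_b^q(U, A)` on the subsets of `X`, with restriction of functions. -/
def CYPresheaf (q : ℕ) : (Set X)ᵒᵖ ⥤ AddCommGrpCat.{u} where
  obj U := AddCommGrpCat.of (CY U.unop A q)
  map f := AddCommGrpCat.ofHom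
    (CY.pullback A (Set.inclusion (leOfHom f.unop)) (fun _ _ => rfl) q)
  map_id U := by
    ext φ
    rfl
  map_comp f g := by
    ext φ
    rfl

/-- The differentials, as morphisms of presheaves. -/
def CYPresheafD (q : ℕ) : CYPresheaf X A q ⟶ CYPresheaf X A (q + 1) where
  app U := AddCommGrpCat.ofHom (CY.d U.unop A q)
  naturality U V f := by
    ext c
    exact (CY.pullback_d A (Set.inclusion (leOfHom f.unop)) (fun _ _ => rfl) q c).symm

/-- The map from the constant presheaf `A` to `CY_b^0(·, A)` sending `a` to the class of the
constant function `a`. -/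
def constPresheafToCY :
    (Functor.const (Set X)ᵒᵖ).obj (AddCommGrpCat.of A) ⟶ CYPresheaf X A 0 where
  app U := AddCommGrpCat.ofHom (CY.const U.unop)
  naturality U V f := by
    ext a
    exact (CY.pullback_const A (Set.inclusion (leOfHom f.unop)) (fun _ _ => rfl) a).symm

/-- The constant sheaf `A_X` on `X_ct`: the sheafification of the constant presheaf. -/
noncomputable def constSheaf : Sheaf (coarseTopology X) AddCommGrpCat.{u} :=
  (constantSheaf (coarseTopology X) AddCommGrpCat.{u}).obj (AddCommGrpCat.of A)

variable {X A}

/-- The morphism of sheaves `A_X → CY_b^0(·, A)` induced by `constPresheafToCY`. -/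
noncomputable def augmentation
    (h : Presheaf.IsSheaf (coarseTopology X) (CYPresheaf X A 0)) :
    constSheaf X A ⟶ ⟨CYPresheaf X A 0, h⟩ :=
  ((sheafificationAdjunction (coarseTopology X) AddCommGrpCat.{u}).homEquiv
    ((Functor.const (Set X)ᵒᵖ).obj (AddCommGrpCat.of A)) ⟨CYPresheaf X A 0, h⟩).symm
      (constPresheafToCY X A)

/-- A sheaf on `X_ct` is flabby if all its restriction maps are surjective. -/
def IsFlabby (F : Sheaf (coarseTopology X) AddCommGrpCat.{u}) : Prop :=
  ∀ ⦃U V : Set X⦄ (h : U ⊆ V), Function.Surjective (F.obj.map (homOfLE h).op)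

/-- `0 → F → G 0 → G 1 → ⋯` is a flabby resolution: every `G q` is flabby and the sequence is exact
in the abelian category of sheaves of abelian groups on `X_ct`. -/
structure IsFlabbyResolution {F : Sheaf (coarseTopology X) AddCommGrpCat.{u}}
    {G : ℕ → Sheaf (coarseTopology X) AddCommGrpCat.{u}} (ε : F ⟶ G 0)
    (d : ∀ q, G q ⟶ G (q + 1)) : Prop where
  flabby : ∀ q, IsFlabby (G q)
  mono : Mono ε
  exact_zero : ∃ w : ε ≫ d 0 = 0, (ShortComplex.mk ε (d 0) w).Exact
  exact_succ : ∀ q, ∃ w : d q ≫ d (q + 1) = 0, (ShortComplex.mk (d q) (d (q + 1)) w).Exact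

variable (X) in
/-- The global sections functor `F ↦ F(X)` on sheaves of abelian groups on `X_ct`. -/
def globalSections : Sheaf (coarseTopology X) AddCommGrpCat.{u} ⥤ AddCommGrpCat.{u} :=
  (sheafSections (coarseTopology X) AddCommGrpCat.{u}).obj (Opposite.op Set.univ)

instance : (globalSections X).Additive where
  map_add := rfl

/-- Coarse sheaf cohomology: the right derived functors of the global sections functor. -/
noncomputable def coarseCohomology (F : Sheaf (coarseTopology X) AddCommGrpCat.{u}) (q : ℕ) :
    AddCommGrpCat.{u} :=
  ((globalSections X).rightDerived q).obj F

end Sheaves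

end Coarse

namespace Coarse

/-! Blocky functions on a subset extend by zero to `X`, so every section of `CY_b^q` is the class of
a global blocky function (`cls_surjective`) and the presheaf is flabby. The sheaf condition is
elementary: a tuple of diameter at most `R` either lies in one member of a coarse cover or has all
its entries in a fixed bounded set. This gives uniqueness (`NegligibleOn.of_isCoarseCover`). For
gluing, each tuple takes its value from one local function whose domain contains it (`exists_glue`).

Exactness rests on `NegligibleOn.exists_isCoarseCover`: a negligible blocky function vanishes
identically on the members of some coarse cover. A cocycle modulo cocontrolled functions is
therefore locally an honest cocycle, and contraction with a base point makes it locally a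
coboundary, or a constant in degree 0.

For cohomology, the resolution is compared with an injective resolution, which is flabby too. The
mapping cone of a comparison map is an exact complex of flabby sheaves (`exact_cone`,
`IsFlabby.biprod`), and such a complex stays exact on sections (`exact_sections_of_isFlabby`). Hence
the comparison map is a quasi-isomorphism on global sections. The lifting of sections behind this
reduces to covers with two members (`IsCoarseCover.induction`, `exists_app_eq`). -/

/-- A blocky function may be described by a partition indexed by any finite type. -/
lemma IsBlocky.of_finite {Y A κ : Type*} [Finite κ] {q : ℕ}
    {φ : (Fin (q + 1) → Y) → A} (p : Y → κ)
    (h : ∀ x y : Fin (q + 1) → Y, (∀ i, p (x i) = p (y i)) → φ x = φ y) : IsBlocky φ := by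
  obtain ⟨n, ⟨e⟩⟩ := Finite.exists_equiv_fin κ
  exact ⟨n, fun x => e (p x), fun x y hxy => h x y fun i => e.injective (hxy i)⟩

/-! ### Negligible blocky functions and coarse covers -/

section Functions

variable {X : Type u} [MetricSpace X] {A : Type v} [AddCommGroup A]

/-- Among the entourages inside `U × U` with distance bound `R` there is a largest one, so the
covering condition concerns distances alone. -/
lemma IsCoarseCover.isBounded_setOf {ι : Type} {U : Set X} {V : ι → Set X}
    (h : IsCoarseCover U V) (R : ℝ) :
    Bornology.IsBounded {x | x ∈ U ∧ ∀ i, ∃ y ∈ U \ V i, dist x y ≤ R} := by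
  refine (h.isBounded {p ∈ U ×ˢ U | dist p.1 p.2 ≤ R} (fun p hp => hp.1)
    ⟨R, fun p hp => hp.2⟩).subset ?_
  rintro x ⟨hxU, hx⟩
  refine ⟨hxU, Set.mem_iInter.2 fun i => ?_⟩
  obtain ⟨y, hy, hxy⟩ := hx i
  exact ⟨y, hy, ⟨hxU, hy.1⟩, hxy⟩

lemma isCoarseCover_of_isBounded_setOf {ι : Type} {U : Set X} {V : ι → Set X}
    (hV : ∀ i, V i ⊆ U)
    (h : ∀ R : ℝ, Bornology.IsBounded {x | x ∈ U ∧ ∀ i, ∃ y ∈ U \ V i, dist x y ≤ R}) :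
    IsCoarseCover U V where
  subset := hV
  isBounded E _ := by
    rintro ⟨R, hR⟩
    refine (h R).subset ?_
    rintro x ⟨hxU, hx⟩
    refine ⟨hxU, fun i => ?_⟩
    obtain ⟨y, hy, hxy⟩ := Set.mem_iInter.1 hx i
    exact ⟨y, hy, hR _ hxy⟩

lemma isCoarseCover_empty {U : Set X} (hU : Bornology.IsBounded U) :
    IsCoarseCover U (fun i : Empty => i.elim) :=
  isCoarseCover_of_isBounded_setOf (fun i => i.elim) fun _ => hU.subset fun _ hx => hx.1

/-- The part of the support of `f` inside `U ^ (q + 1)` is cocontrolled. -/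
def NegligibleOn {q : ℕ} (U : Set X) (f : (Fin (q + 1) → X) → A) : Prop :=
  ∀ R : ℝ, ∃ B : Set X, Bornology.IsBounded B ∧ ∀ x : Fin (q + 1) → X, (∀ k, x k ∈ U) →
    (∀ i j, dist (x i) (x j) ≤ R) → f x ≠ 0 → ∀ k, x k ∈ B

variable (A) in
/-- The class in `CY_b^q(U, A)` of the restriction to `U` of a blocky function on `X`. -/
def cls (U : Set X) (q : ℕ) : blocky X A q →+ CY U A q :=
  (QuotientAddGroup.mk' (CX U A q)).comp (blockyPullback A (Subtype.val : U → X) q)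

/-- This replaces tuples in a subtype by tuples in `X`. One bounded set serves all coordinates
because there are finitely many. -/
lemma negligibleOn_iff {q : ℕ} (U : Set X) (f : (Fin (q + 1) → X) → A) :
    NegligibleOn U f ↔
      IsCocontrolled (Function.support fun z : Fin (q + 1) → U => f fun i => z i) := by
  constructor
  · intro h R _ k
    obtain ⟨B, hB, h⟩ := h R
    rw [← Bornology.isBounded_image_subtype_val]
    refine hB.subset ?_
    rintro _ ⟨_, ⟨z, ⟨hz, hzR⟩, rfl⟩, rfl⟩
    exact h (fun i => z i) (fun i => (z i).2) hzR hz k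
  · intro h R
    by_cases hR : 0 ≤ R
    · refine ⟨⋃ k, Subtype.val '' _, Bornology.isBounded_iUnion.2 fun k =>
        Bornology.isBounded_image_subtype_val.2 (h R hR k), fun x hx hxR hfx k => ?_⟩
      exact Set.mem_iUnion.2 ⟨k, ⟨x k, hx k⟩, ⟨fun i => ⟨x i, hx i⟩, ⟨hfx, hxR⟩, rfl⟩, rfl⟩
    · refine ⟨∅, Bornology.isBounded_empty, fun x _ hxR _ _ => (hR ?_).elim⟩
      simpa using hxR 0 0

lemma cls_eq_zero_iff {q : ℕ} (U : Set X) (f : blocky X A q) :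
    cls A U q f = 0 ↔ NegligibleOn U f.1 := by
  rw [negligibleOn_iff]
  exact QuotientAddGroup.eq_zero_iff _

/-- Extension by zero stays blocky once the complement of `U` is added as one more block, labelled
`none`. -/
lemma cls_surjective (U : Set X) (q : ℕ) : Function.Surjective (cls A U q) := by
  classical
  intro c
  obtain ⟨⟨φ, n, p, hp⟩, rfl⟩ := QuotientAddGroup.mk_surjective c
  let f : (Fin (q + 1) → X) → A := fun x =>
    if hx : ∀ k, x k ∈ U then φ fun k => ⟨x k, hx k⟩ else 0
  have hf : IsBlocky f := by
    let r : X → Option (Fin n) := fun x => if hx : x ∈ U then some (p ⟨x, hx⟩) else none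
    have hr : ∀ x y, r x = r y → ((x ∈ U ↔ y ∈ U) ∧
        ∀ hx hy, p ⟨x, hx⟩ = p ⟨y, hy⟩) := by
      intro x y h
      by_cases hx : x ∈ U <;> by_cases hy : y ∈ U <;> simp [r, hx, hy] at h ⊢
      exact h
    refine IsBlocky.of_finite r fun x y hxy => ?_
    by_cases hx : ∀ k, x k ∈ U
    · have hy : ∀ k, y k ∈ U := fun k => (hr _ _ (hxy k)).1.1 (hx k)
      simp only [f, dif_pos hx, dif_pos hy]
      exact hp _ _ fun i => (hr _ _ (hxy i)).2 _ _
    · have hy : ¬ ∀ k, y k ∈ U := fun hy => hx fun k => (hr _ _ (hxy k)).1.2 (hy k)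
      simp only [f, dif_neg hx, dif_neg hy]
  refine ⟨⟨f, hf⟩, congrArg QuotientAddGroup.mk (Subtype.ext (funext fun z => ?_))⟩
  exact dif_pos fun k => (z k).2

lemma d_cls (U : Set X) (q : ℕ) (f : blocky X A q) :
    CY.d U A q (cls A U q f) = cls A U (q + 1) (blockyD X A q f) := rfl

lemma cls_eq_cls_iff {q : ℕ} (U : Set X) (f g : blocky X A q) :
    cls A U q f = cls A U q g ↔ NegligibleOn U (f.1 - g.1) := by
  rw [← sub_eq_zero, ← map_sub, cls_eq_zero_iff]
  rfl

lemma NegligibleOn.of_eq_zero {q : ℕ} {U : Set X} {f : (Fin (q + 1) → X) → A}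
    (h : ∀ x : Fin (q + 1) → X, (∀ k, x k ∈ U) → f x = 0) : NegligibleOn U f := fun _ =>
  ⟨∅, Bornology.isBounded_empty, fun x hx _ hfx => (hfx (h x hx)).elim⟩

/-- A tuple of diameter at most `R` that lies in no `V i` has, for each `i`, an entry outside `V i`.
All its entries are then within `R` of every `U \ V i`, a bounded region. -/
lemma NegligibleOn.of_isCoarseCover {ι : Type} [Finite ι] {U : Set X} {V : ι → Set X}
    (hV : IsCoarseCover U V) {q : ℕ} {f : (Fin (q + 1) → X) → A}
    (h : ∀ i, NegligibleOn (V i) f) : NegligibleOn U f := by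
  intro R
  choose B hB hfB using fun i => h i R
  refine ⟨(⋃ i, B i) ∪ {x | x ∈ U ∧ ∀ i, ∃ y ∈ U \ V i, dist x y ≤ R},
    (Bornology.isBounded_iUnion.2 hB).union (hV.isBounded_setOf R), fun x hx hxR hfx k => ?_⟩
  by_cases hall : ∃ i, ∀ k, x k ∈ V i
  · obtain ⟨i, hi⟩ := hall
    exact Or.inl (Set.mem_iUnion.2 ⟨i, hfB i x hi hxR hfx k⟩)
  · push Not at hall
    refine Or.inr ⟨hx k, fun i => ?_⟩
    obtain ⟨l, hl⟩ := hall i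
    exact ⟨x l, ⟨hx l, hl⟩, hxR k l⟩

/-- A blocky function which is negligible on `U` vanishes on the members of a coarse cover. -/
lemma NegligibleOn.exists_isCoarseCover {U : Set X} {q : ℕ} {f : (Fin (q + 1) → X) → A}
    (hb : IsBlocky f) (h : NegligibleOn U f) :
    ∃ (ι : Type) (_ : Finite ι) (V : ι → Set X), IsCoarseCover U V ∧
      ∀ i, ∀ x : Fin (q + 1) → X, (∀ k, x k ∈ V i) → f x = 0 := by
  obtain ⟨n, p, hp⟩ := hb
  -- The bad tuples of blocks are those where `f` is nonzero. A member of the cover is given by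
  -- choosing one block from each tuple of blocks and deleting those chosen from bad tuples.
  let bad : (Fin (q + 1) → Fin n) → Prop := fun t => ∃ x, (∀ k, p (x k) = t k) ∧ f x ≠ 0
  refine ⟨(Fin (q + 1) → Fin n) → Fin (q + 1), inferInstance,
    fun s => {x | x ∈ U ∧ ∀ t, bad t → p x ≠ t (s t)},
    isCoarseCover_of_isBounded_setOf (fun s x hx => hx.1) fun R => ?_, fun s x hx => ?_⟩
  -- Points within `R` of `x` are at most `R + R` apart.
  · obtain ⟨B, hB, hfB⟩ := h (R + R)
    refine (hB.cthickening (δ := R)).subset ?_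
    rintro x ⟨hxU, hx⟩
    -- Otherwise every bad tuple has a block missing the `R`-ball around `x`. Choosing these blocks
    -- gives a member of the cover that contains the whole ball inside `U`.
    obtain ⟨t, ht, hxt⟩ : ∃ t, bad t ∧ ∀ k, ∃ y ∈ U, dist x y ≤ R ∧ p y = t k := by
      by_contra! hcon
      have : ∀ t, ∃ k, bad t → ∀ y ∈ U, dist x y ≤ R → p y ≠ t k := by
        intro t
        by_cases ht : bad t
        · obtain ⟨k, hk⟩ := hcon t ht
          exact ⟨k, fun _ => hk⟩
        · exact ⟨0, fun h => (ht h).elim⟩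
      choose s hs using this
      obtain ⟨y, ⟨hyU, hy⟩, hxy⟩ := hx s
      exact hy ⟨hyU, fun t ht => hs t ht y hyU hxy⟩
    choose y hyU hxy hyt using hxt
    obtain ⟨z, hz, hfz⟩ := ht
    have hfy : f y ≠ 0 := by
      rwa [hp y z fun k => (hyt k).trans (hz k).symm]
    refine Metric.mem_cthickening_of_dist_le _ (y 0) _ _ ?_ (hxy 0)
    exact hfB y hyU (fun i j => (dist_triangle_left _ _ x).trans
      (add_le_add (hxy i) (hxy j))) hfy 0
  · by_contra hfx
    exact (hx (s fun k => p (x k))).2 _ ⟨x, fun _ => rfl, hfx⟩ rfl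

/-- The index used on a tuple depends only on the set of all `i` for which `V i` contains the tuple.
The glued function is thus blocky for the common refinement of the given partitions and the sets `V
i`. -/
lemma exists_glue {ι : Type} [Finite ι] (V : ι → Set X) {q : ℕ} (f : ι → blocky X A q)
    (h : ∀ i j, NegligibleOn (V i ∩ V j) ((f i).1 - (f j).1)) :
    ∃ g : blocky X A q, ∀ i, NegligibleOn (V i) (g.1 - (f i).1) := by
  classical
  obtain ⟨c, hc⟩ : ∃ c : Set ι → Option ι, ∀ T : Set ι, (∀ i, c T = some i → i ∈ T) ∧
      (T.Nonempty → ∃ i, c T = some i) := by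
    refine ⟨fun T => if h : T.Nonempty then some h.some else none, fun T => ⟨?_, ?_⟩⟩
    · intro i hi
      by_cases h : T.Nonempty
      · simp only [dif_pos h, Option.some.injEq] at hi
        exact hi ▸ h.some_mem
      · simp [dif_neg h] at hi
    · intro h
      exact ⟨h.some, dif_pos h⟩
  let T : (Fin (q + 1) → X) → Set ι := fun x => {i | ∀ k, x k ∈ V i}
  let g : (Fin (q + 1) → X) → A := fun x => (c (T x)).elim 0 fun i => (f i).1 x
  have hg : IsBlocky g := by
    choose n p hp using fun i => (f i).2
    refine IsBlocky.of_finite (κ := ∀ i, Fin (n i) × Prop)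
      (fun x i => (p i x, x ∈ V i)) fun x y hxy => ?_
    have h1 : ∀ k i, p i (x k) = p i (y k) := fun k i => congrArg Prod.fst (congrFun (hxy k) i)
    have h2 : ∀ k i, (x k ∈ V i) = (y k ∈ V i) := fun k i =>
      congrArg Prod.snd (congrFun (hxy k) i)
    have hT : T x = T y := by
      ext i
      simp only [T, Set.mem_ofPred_eq, h2]
    simp only [g, hT]
    cases c (T y) with
    | none => rfl
    | some i => exact hp i x y fun k => h1 k i
  refine ⟨⟨g, hg⟩, fun i R => ?_⟩
  choose B hB hfB using fun j => h j i R
  refine ⟨⋃ j, B j, Bornology.isBounded_iUnion.2 hB, fun x hx hxR hgx k => ?_⟩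
  obtain ⟨j, hj⟩ := (hc (T x)).2 ⟨i, hx⟩
  have hgj : g x = (f j).1 x := by simp only [g, hj, Option.elim]
  have hxj : ∀ k, x k ∈ V j := (hc (T x)).1 j hj
  refine Set.mem_iUnion.2 ⟨j, hfB j x (fun k => ⟨hxj k, hx k⟩) hxR ?_ k⟩
  simpa [hgj] using hgx

/-- On a set where the coboundary of a blocky function of positive degree vanishes, the function
is the coboundary of its contraction with a base point. -/
lemma exists_eq_coboundary {q : ℕ} {f : (Fin (q + 2) → X) → A} (hf : IsBlocky f) {V : Set X}
    (h : ∀ x : Fin (q + 3) → X, (∀ k, x k ∈ V) → coboundary X A (q + 1) f x = 0) :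
    ∃ g : blocky X A q, ∀ x : Fin (q + 2) → X, (∀ k, x k ∈ V) →
      coboundary X A q g.1 x = f x := by
  rcases V.eq_empty_or_nonempty with rfl | ⟨a, ha⟩
  · exact ⟨0, fun x hx => (hx 0).elim⟩
  obtain ⟨n, p, hp⟩ := hf
  refine ⟨⟨fun x => f (Fin.cons a x), n, p, fun x y hxy => hp _ _ fun i => ?_⟩, fun x hx => ?_⟩
  · refine Fin.cases rfl (fun j => ?_) i
    simpa using hxy j
  -- In the vanishing coboundary at `(a, x)`, omitting `a` gives `f x`, and the other faces sum to
  -- minus the coboundary of the contraction.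
  · have key := h (Fin.cons a x) fun k => Fin.cases ha (fun j => by simpa using hx j) k
    rw [coboundary_apply, Fin.sum_univ_succ] at key
    have e0 : (fun j => (Fin.cons a x : Fin (q + 3) → X) (Fin.succAbove 0 j)) = x := by
      ext j
      simp
    have es : ∀ i : Fin (q + 2), (fun j => (Fin.cons a x : Fin (q + 3) → X) (i.succ.succAbove j)) =
        Fin.cons a fun j => x (i.succAbove j) := by
      intro i
      ext j
      refine Fin.cases ?_ (fun j => ?_) j <;> simp
    simp only [e0, es, Fin.val_zero, pow_zero, one_smul, Fin.val_succ, pow_succ, mul_neg, mul_one,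
      neg_smul, Finset.sum_neg_distrib] at key
    rw [coboundary_apply]
    exact (add_neg_eq_zero.1 key).symm

lemma eq_of_coboundary_eq_zero {f : (Fin 1 → X) → A} {V : Set X}
    (h : ∀ x : Fin 2 → X, (∀ k, x k ∈ V) → coboundary X A 0 f x = 0)
    (x y : Fin 1 → X) (hx : ∀ k, x k ∈ V) (hy : ∀ k, y k ∈ V) : f x = f y := by
  have key := h ![y 0, x 0] fun k => by fin_cases k <;> simp [hx, hy]
  rw [coboundary_apply, Fin.sum_univ_two] at key
  have e0 : (fun j => (![y 0, x 0] : Fin 2 → X) (Fin.succAbove 0 j)) = x := by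
    ext j
    fin_cases j
    simp
  have e1 : (fun j => (![y 0, x 0] : Fin 2 → X) (Fin.succAbove 1 j)) = y := by
    ext j
    fin_cases j
    simp
  simp only [e0, e1, Fin.val_zero, pow_zero, one_smul, Fin.val_one, pow_one, neg_smul] at key
  exact add_neg_eq_zero.1 key

end Functions

/-! ### The sheaf condition -/

section Presheaf

variable (X : Type u) [MetricSpace X] (A : Type u) [AddCommGroup A]

lemma isSheaf_CYPresheaf (q : ℕ) :
    Presheaf.IsSheaf (coarseTopology X) (CYPresheaf X A q) := by
  rw [Presheaf.isSheaf_iff_isSheaf_forget _ _ (forget AddCommGrpCat.{u}),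
    isSheaf_iff_isSheaf_of_type]
  rintro U S ⟨ι, _, V, hV, hS⟩ x hx
  choose f hf using fun i => cls_surjective (A := A) (V i) q (x (homOfLE (hV.subset i)) (hS i))
  have hcls : ∀ (W : Set X) (i : ι), W ⊆ V i → ∀ hW : W ⊆ U, ∀ hSW : S (homOfLE hW),
      x (homOfLE hW) hSW = cls A W q (f i) := by
    intro W i hWi hW hSW
    have := hx (𝟙 W) (homOfLE hWi) hSW (hS i) (Subsingleton.elim _ _)
    simp only [op_id, Functor.map_id_apply, ← hf] at this
    exact this
  obtain ⟨g, hg⟩ := exists_glue V f fun i j => by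
    rw [← cls_eq_cls_iff]
    have hW : V i ∩ V j ⊆ U := Set.inter_subset_left.trans (hV.subset i)
    have hSW : S (homOfLE hW) := S.downward_closed (hS i) (homOfLE Set.inter_subset_left)
    rw [← hcls _ i Set.inter_subset_left hW hSW, ← hcls _ j Set.inter_subset_right hW hSW]
  refine ⟨cls A U q g, fun W k hSW => ?_, fun c hc => ?_⟩
  · have hW : W ⊆ U := leOfHom k
    obtain ⟨w, hw⟩ := cls_surjective (A := A) W q (x k hSW)
    rw [← hw]
    change cls A W q g = cls A W q w
    rw [cls_eq_cls_iff]
    -- A set `W` of the sieve need not lie in any `V i`, so agreement is tested on the induced cover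
    -- of `W`.
    refine NegligibleOn.of_isCoarseCover (hV.inter hW) fun i => ?_
    rw [← cls_eq_cls_iff]
    have hWi : V i ∩ W ⊆ U := Set.inter_subset_right.trans hW
    have h1 := hx (homOfLE (Set.inter_subset_right : V i ∩ W ⊆ W)) (𝟙 (V i ∩ W))
      hSW (S.downward_closed (hS i) (homOfLE Set.inter_subset_left) : S (homOfLE hWi))
      (Subsingleton.elim _ _)
    simp only [op_id, Functor.map_id_apply, ← hw] at h1
    refine Eq.trans ?_ (h1.trans (hcls _ i Set.inter_subset_left hWi _)).symm
    rw [cls_eq_cls_iff]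
    intro R
    obtain ⟨B, hB, h⟩ := hg i R
    exact ⟨B, hB, fun x hx => h x fun k => (hx k).1⟩
  · obtain ⟨w, rfl⟩ := cls_surjective (A := A) U q c
    change cls A U q w = cls A U q g
    rw [cls_eq_cls_iff]
    refine NegligibleOn.of_isCoarseCover hV fun i => ?_
    rw [← cls_eq_cls_iff]
    have h1 := hc (homOfLE (hV.subset i)) (hS i)
    rw [← hf i] at h1
    refine Eq.trans h1 (Eq.symm ?_)
    rw [cls_eq_cls_iff]
    exact hg i

end Presheaf

/-! ### Exactness of sequences of abelian sheaves -/

section Exactness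

open Limits Opposite

variable {C : Type u} [SmallCategory C] {J : GrothendieckTopology C}

instance preservesFiniteLimits_sheafSections (U : Cᵒᵖ) :
    PreservesFiniteLimits ((sheafSections J AddCommGrpCat.{u}).obj U) :=
  inferInstanceAs (PreservesFiniteLimits
    (sheafToPresheaf J AddCommGrpCat.{u} ⋙ (evaluation _ _).obj U))

instance additive_sheafSections (U : Cᵒᵖ) :
    ((sheafSections J AddCommGrpCat.{u}).obj U).Additive where
  map_add := rfl

lemma injective_app_of_mono {F G : Sheaf J AddCommGrpCat.{u}} (f : F ⟶ G) [Mono f] (U : Cᵒᵖ) :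
    Function.Injective (f.hom.app U) :=
  (AddCommGrpCat.mono_iff_injective _).1
    (inferInstanceAs (Mono (((sheafSections J AddCommGrpCat.{u}).obj U).map f)))

lemma exists_kernel_ι_eq {F G : Sheaf J AddCommGrpCat.{u}} (g : F ⟶ G) {U : Cᵒᵖ}
    (s : F.obj.obj U) (hs : g.hom.app U s = 0) :
    ∃ t, (kernel.ι g).hom.app U t = s := by
  let S := ShortComplex.mk (kernel.ι g) g (kernel.condition g)
  have hS : S.Exact := S.exact_of_f_is_kernel (kernelIsKernel g)
  have : Mono S.f := inferInstanceAs (Mono (kernel.ι g))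
  have h := hS.map_of_mono_of_preservesKernel ((sheafSections J AddCommGrpCat.{u}).obj U)
    inferInstance inferInstance
  exact (ShortComplex.ab_exact_iff _).1 h s hs

/-- A complex of abelian sheaves is exact if and only if cycles locally are boundaries. -/
lemma exact_iff_imageSieve_mem (S : ShortComplex (Sheaf J AddCommGrpCat.{u})) :
    S.Exact ↔ ∀ (U : C) (s : S.X₂.obj.obj (op U)), S.g.hom.app (op U) s = 0 →
      Presheaf.imageSieve S.f.hom s ∈ J U := by
  rw [S.exact_iff_epi_kernel_lift, ← Sheaf.isLocallySurjective_iff_epi']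
  -- The kernel inclusion is injective on sections, so lifting a section locally through the kernel
  -- is the same as lifting its image in the middle term.
  have key : ∀ (U : C) (t : (kernel S.g).obj.obj (op U)),
      Presheaf.imageSieve (kernel.lift S.g S.f S.zero).hom t =
        Presheaf.imageSieve S.f.hom ((kernel.ι S.g).hom.app (op U) t) := by
    intro U t
    have hfac : (kernel.lift S.g S.f S.zero).hom ≫ (kernel.ι S.g).hom = S.f.hom :=
      congrArg (fun f => f.hom) (kernel.lift_ι S.g S.f S.zero)
    ext V i
    refine exists_congr fun r => ?_
    rw [← (injective_app_of_mono (kernel.ι S.g) (op V)).eq_iff, ← hfac]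
    simp only [NatTrans.comp_app, ConcreteCategory.comp_apply, NatTrans.naturality_apply]
  constructor
  · rintro ⟨h⟩ U s hs
    obtain ⟨t, rfl⟩ := exists_kernel_ι_eq S.g s hs
    rw [← key]
    exact h t
  · refine fun h => ⟨fun {U} t => ?_⟩
    rw [key]
    refine h _ _ ?_
    have := congrArg (fun f => f.hom.app (op U)) (kernel.condition S.g)
    exact ConcreteCategory.congr_hom this t

end Exactness
-- The resolution of the constant sheaf
section Resolution

open Limits Opposite

variable {X : Type u} [MetricSpace X] {A : Type u} [AddCommGroup A]

lemma const_eq_cls (U : Set X) (a : A) :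
    CY.const U a = cls A U 0 ⟨fun _ => a, 1, fun _ => 0, fun _ _ _ => rfl⟩ := rfl

lemma isBounded_of_negligibleOn_const {U : Set X} {a : A} (ha : a ≠ 0) {q : ℕ}
    (h : NegligibleOn U fun _ : Fin (q + 1) → X => a) : Bornology.IsBounded U := by
  obtain ⟨B, hB, h⟩ := h 0
  exact hB.subset fun x hx => h (fun _ => x) (fun _ => hx) (fun _ _ => (dist_self x).le) ha 0

/-- Distinct constants can have the same class only over a bounded set, and a bounded set is covered
by the empty family. -/
lemma isLocallyInjective_constPresheafToCY :
    Presheaf.IsLocallyInjective (coarseTopology X) (constPresheafToCY X A) := by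
  refine ⟨fun {U} a b hab => ?_⟩
  by_cases h : a = b
  · subst h
    simp
  · have hab' : cls A U.unop 0 ⟨fun _ => a, 1, fun _ => 0, fun _ _ _ => rfl⟩ =
        cls A U.unop 0 ⟨fun _ => b, 1, fun _ => 0, fun _ _ _ => rfl⟩ := hab
    rw [cls_eq_cls_iff] at hab'
    exact ⟨Empty, inferInstance, _,
      isCoarseCover_empty (isBounded_of_negligibleOn_const (sub_ne_zero.2 h) hab'),
      fun i => i.elim⟩

lemma toSheafify_augmentation
    (h : Presheaf.IsSheaf (coarseTopology X) (CYPresheaf X A 0)) :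
    toSheafify (coarseTopology X) ((Functor.const (Set X)ᵒᵖ).obj (AddCommGrpCat.of A)) ≫
      (augmentation h).hom = constPresheafToCY X A :=
  ((sheafificationAdjunction (coarseTopology X) AddCommGrpCat.{u}).homEquiv
    ((Functor.const (Set X)ᵒᵖ).obj (AddCommGrpCat.of A)) ⟨CYPresheaf X A 0, h⟩).apply_symm_apply
      (constPresheafToCY X A)

lemma exists_augmentation_eq (h : Presheaf.IsSheaf (coarseTopology X) (CYPresheaf X A 0))
    (U : Set X) (a : A) :
    ∃ t, (augmentation h).hom.app (op U) t = CY.const U a :=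
  ⟨(toSheafify (coarseTopology X)
    ((Functor.const (Set X)ᵒᵖ).obj (AddCommGrpCat.of A))).app (op U) a,
    ConcreteCategory.congr_hom (congrArg (fun f => f.app (op U)) (toSheafify_augmentation h)) a⟩

/-- Local injectivity descends from the constant presheaf to its sheafification because the unit is
locally surjective. -/
lemma mono_augmentation (h : Presheaf.IsSheaf (coarseTopology X) (CYPresheaf X A 0)) :
    Mono (augmentation h) := by
  have : Sheaf.IsLocallyInjective (augmentation h) := by
    have h1 := isLocallyInjective_constPresheafToCY (X := X) (A := A)
    have h2 := ((coarseTopology X).W_toSheafify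
      ((Functor.const (Set X)ᵒᵖ).obj (AddCommGrpCat.of A))).isLocallySurjective
    exact Presheaf.isLocallyInjective_of_isLocallyInjective_of_isLocallySurjective_fac
      (coarseTopology X) (F₂ := sheafify (coarseTopology X) _) _ (toSheafify_augmentation h)
  exact Sheaf.mono_of_isLocallyInjective _

lemma constPresheafToCY_comp_d : constPresheafToCY X A ≫ CYPresheafD X A 0 = 0 := by
  ext U a
  change CY.d U.unop A 0 (CY.const U.unop a) = 0
  rw [const_eq_cls, d_cls, cls_eq_zero_iff]
  refine NegligibleOn.of_eq_zero fun x _ => ?_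
  change coboundary X A 0 (fun _ => a) x = 0
  simp [coboundary_apply, Fin.sum_univ_two]

lemma augmentation_comp_d (h : ∀ q, Presheaf.IsSheaf (coarseTopology X) (CYPresheaf X A q)) :
    augmentation (h 0) ≫ (ObjectProperty.homMk (CYPresheafD X A 0) :
      (⟨CYPresheaf X A 0, h 0⟩ : Sheaf (coarseTopology X) AddCommGrpCat.{u}) ⟶
        ⟨CYPresheaf X A 1, h 1⟩) = 0 := by
  refine ObjectProperty.hom_ext _ (sheafify_hom_ext (coarseTopology X) _ _ (h 1) ?_)
  refine Eq.trans (b := constPresheafToCY X A ≫ CYPresheafD X A 0) ?_ ?_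
  · exact congrArg (· ≫ CYPresheafD X A 0) (toSheafify_augmentation (h 0))
  · rw [constPresheafToCY_comp_d]
    exact comp_zero.symm

lemma isFlabbyResolution_CY
    (h : ∀ q, Presheaf.IsSheaf (coarseTopology X) (CYPresheaf X A q)) :
    IsFlabbyResolution (G := fun q => ⟨CYPresheaf X A q, h q⟩)
      (augmentation (h 0)) (fun q => ObjectProperty.homMk (CYPresheafD X A q)) where
  flabby q U V hUV c := by
    obtain ⟨f, rfl⟩ := cls_surjective (A := A) U q c
    exact ⟨cls A V q f, rfl⟩
  mono := mono_augmentation (h 0)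
  exact_zero := by
    refine ⟨augmentation_comp_d h, (exact_iff_imageSieve_mem _).2 fun U s hs => ?_⟩
    obtain ⟨f, rfl⟩ := cls_surjective (A := A) U 0 s
    have hf : NegligibleOn U (blockyD X A 0 f).1 := (cls_eq_zero_iff U _).1 hs
    -- On each `V i` the coboundary is now zero as a function, not merely modulo cocontrolled
    -- support.
    obtain ⟨ι, hι, V, hV, hfV⟩ := hf.exists_isCoarseCover (blockyD X A 0 f).2
    refine ⟨ι, hι, V, hV, fun i => ?_⟩
    obtain ⟨a, ha⟩ : ∃ a : A, cls A (V i) 0 f = CY.const (V i) a := by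
      rcases (V i).eq_empty_or_nonempty with hVi | ⟨y, hy⟩
      · refine ⟨0, Eq.trans ((cls_eq_cls_iff _ _ 0).2 (NegligibleOn.of_eq_zero fun x hx => ?_))
          (map_zero _)⟩
        simpa [hVi] using hx 0
      · refine ⟨f.1 fun _ => y, ?_⟩
        rw [const_eq_cls]
        refine (cls_eq_cls_iff _ _ _).2 (NegligibleOn.of_eq_zero fun x hx => ?_)
        exact sub_eq_zero.2 (eq_of_coboundary_eq_zero (hfV i) x _ hx fun _ => hy)
    obtain ⟨t, ht⟩ := exists_augmentation_eq (h 0) (V i) a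
    exact ⟨t, ht.trans ha.symm⟩
  exact_succ q := by
    refine ⟨?_, (exact_iff_imageSieve_mem _).2 fun U s hs => ?_⟩
    · refine ObjectProperty.hom_ext _ ?_
      ext U c
      exact CY.d_d U.unop A q c
    obtain ⟨f, rfl⟩ := cls_surjective (A := A) U (q + 1) s
    have hf : NegligibleOn U (blockyD X A (q + 1) f).1 := (cls_eq_zero_iff U _).1 hs
    obtain ⟨ι, hι, V, hV, hfV⟩ := hf.exists_isCoarseCover (blockyD X A (q + 1) f).2
    refine ⟨ι, hι, V, hV, fun i => ?_⟩
    obtain ⟨g, hg⟩ := exists_eq_coboundary f.2 (hfV i)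
    refine ⟨cls A (V i) q g, ?_⟩
    refine (cls_eq_cls_iff (V i) (blockyD X A q g) f).2 (NegligibleOn.of_eq_zero fun x hx => ?_)
    exact sub_eq_zero.2 (hg x hx)

end Resolution
-- Reduction to covers with two members
section Covers

variable {X : Type u} [MetricSpace X]

/-- Coarse covers are generated by empty covers of bounded sets and covers with two members. -/
lemma IsCoarseCover.induction {P : Set X → Prop}
    (mono : ∀ ⦃U V⦄, V ⊆ U → P U → P V) (bounded : ∀ ⦃U⦄, Bornology.IsBounded U → P U)
    (glue : ∀ ⦃U V W : Set X⦄, IsCoarseCover U (fun b : Bool => bif b then V else W) →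
      P V → P W → P U)
    {ι : Type} [Finite ι] {U : Set X} {V : ι → Set X} (hV : IsCoarseCover U V)
    (h : ∀ i, P (V i)) : P U := by
  refine Finite.induction_empty_option (P := fun κ : Type => ∀ (U : Set X) (V : κ → Set X),
    IsCoarseCover U V → (∀ i, P (V i)) → P U) ?_ ?_ ?_ ι U V hV h
  · intro α β e ih U V hV h
    refine ih U (fun a => V (e a)) ?_ fun a => h (e a)
    refine isCoarseCover_of_isBounded_setOf (fun a => hV.subset _) fun R => ?_
    refine (hV.isBounded_setOf R).subset fun x hx => ⟨hx.1, fun b => ?_⟩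
    simpa using hx.2 (e.symm b)
  · intro U V hV _
    exact bounded ((hV.isBounded_setOf 0).subset fun x hx => ⟨hx, fun i => i.elim⟩)
  · intro α _ ih U V hV h
    -- `near` is the distance to the farthest complement among the members other than `V none`. On
    -- `W` the complement of `V none` is no farther than that, so the other members alone cover `W`.
    -- Off `W` every other complement is closer than that of `V none`, so `W` and `V none` cover
    -- `U`.
    let near : X → ENNReal := fun x => ⨆ a, Metric.infEDist x (U \ V (some a))
    let W : Set X := {x | x ∈ U ∧ Metric.infEDist x (U \ V none) ≤ near x}
    have hWU : W ⊆ U := fun x hx => hx.1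
    have hW : P W := by
      refine ih W (fun a => V (some a) ∩ W) ?_ fun a => mono Set.inter_subset_left (h (some a))
      refine isCoarseCover_of_isBounded_setOf (fun a => Set.inter_subset_right) fun R => ?_
      -- The infimum distance need not be attained. The slack 1 gives a strict inequality and hence
      -- an actual nearby point.
      refine (hV.isBounded_setOf (max R 0 + 1)).subset ?_
      rintro x ⟨hxW, hx⟩
      have hx' : ∀ a, ∃ y ∈ U \ V (some a), dist x y ≤ max R 0 := fun a => by
        obtain ⟨y, hy, hxy⟩ := hx a
        exact ⟨y, ⟨hWU hy.1, fun hyV => hy.2 ⟨hyV, hy.1⟩⟩, hxy.trans (le_max_left _ _)⟩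
      have hnear : near x ≤ ENNReal.ofReal (max R 0) := iSup_le fun a => by
        obtain ⟨y, hy, hxy⟩ := hx' a
        refine (Metric.infEDist_le_edist_of_mem hy).trans ?_
        rw [edist_dist]
        exact ENNReal.ofReal_le_ofReal hxy
      have hlt : Metric.infEDist x (U \ V none) < ENNReal.ofReal (max R 0 + 1) :=
        (hxW.2.trans hnear).trans_lt
          ((ENNReal.ofReal_lt_ofReal_iff (by positivity)).2 (lt_add_one _))
      refine ⟨hWU hxW, fun o => ?_⟩
      cases o with
      | none =>
        obtain ⟨y, hy, hxy⟩ := Metric.infEDist_lt_iff.1 hlt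
        rw [edist_dist, ENNReal.ofReal_lt_ofReal_iff (by positivity)] at hxy
        exact ⟨y, hy, hxy.le⟩
      | some a =>
        obtain ⟨y, hy, hxy⟩ := hx' a
        exact ⟨y, hy, hxy.trans (lt_add_one _).le⟩
    refine glue (V := W) (W := V none) ?_ hW (h none)
    refine isCoarseCover_of_isBounded_setOf (fun b => ?_) fun R => ?_
    · cases b
      · exact hV.subset none
      · exact hWU
    -- From `x` one reaches `y` outside `W` within `R`. From `y` every other complement is closer
    -- than `z`, which is within `R + R` of `y`.
    refine (hV.isBounded_setOf (R + (R + R))).subset ?_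
    rintro x ⟨hxU, hx⟩
    obtain ⟨y, ⟨hyU, hyW⟩, hxy⟩ := hx true
    obtain ⟨z, hz, hxz⟩ := hx false
    have hR : 0 ≤ R := dist_nonneg.trans hxy
    have hyz : dist y z ≤ R + R := (dist_triangle_left _ _ x).trans (add_le_add hxy hxz)
    have hlt : near y < ENNReal.ofReal (dist y z) := by
      rw [← edist_dist]
      refine lt_of_lt_of_le (lt_of_not_ge fun hle => hyW ⟨hyU, hle⟩)
        (Metric.infEDist_le_edist_of_mem hz)
    refine ⟨hxU, fun o => ?_⟩
    cases o with
    | none => exact ⟨z, hz, hxz.trans (by linarith)⟩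
    | some a =>
      obtain ⟨w, hw, hyw⟩ := Metric.infEDist_lt_iff.1
        ((le_iSup (fun a => Metric.infEDist y (U \ V (some a))) a).trans_lt hlt)
      rw [edist_dist, ENNReal.ofReal_lt_ofReal_iff_of_nonneg dist_nonneg] at hyw
      exact ⟨w, hw, (dist_triangle x y w).trans (add_le_add hxy (hyw.le.trans hyz))⟩

end Covers

/-! ### Gluing and lifting of sections -/

section Sections

open Opposite

variable {X : Type u}

/-- Restriction of sections of a presheaf. -/
def res (P : (Set X)ᵒᵖ ⥤ AddCommGrpCat.{u}) {U V : Set X} (h : V ⊆ U) :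
    P.obj (op U) →+ P.obj (op V) :=
  (P.map (homOfLE h).op).hom

lemma res_res (P : (Set X)ᵒᵖ ⥤ AddCommGrpCat.{u}) {U V W : Set X} (h : V ⊆ U) (h' : W ⊆ V)
    (s : P.obj (op U)) : res P h' (res P h s) = res P (h'.trans h) s :=
  (ConcreteCategory.congr_hom (P.map_comp (homOfLE h).op (homOfLE h').op) s).symm

lemma res_self (P : (Set X)ᵒᵖ ⥤ AddCommGrpCat.{u}) {U : Set X} (h : U ⊆ U) (s : P.obj (op U)) :
    res P h s = s :=
  ConcreteCategory.congr_hom (P.map_id (op U)) s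

lemma app_res {P Q : (Set X)ᵒᵖ ⥤ AddCommGrpCat.{u}} (f : P ⟶ Q) {U V : Set X} (h : V ⊆ U)
    (s : P.obj (op U)) : f.app (op V) (res P h s) = res Q h (f.app (op U) s) :=
  NatTrans.naturality_apply f (homOfLE h).op s

variable [MetricSpace X]

lemma existsUnique_glue (F : Sheaf (coarseTopology X) AddCommGrpCat.{u}) {ι : Type} [Finite ι]
    {U : Set X} {V : ι → Set X} (hV : IsCoarseCover U V) (s : ∀ i, F.obj.obj (op (V i)))
    (hs : ∀ i j, res F.obj (Set.inter_subset_left : V i ∩ V j ⊆ V i) (s i) =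
      res F.obj Set.inter_subset_right (s j)) :
    ∃! t : F.obj.obj (op U), ∀ i, res F.obj (hV.subset i) t = s i := by
  have hF := F.property
  rw [Presheaf.isSheaf_iff_isSheaf_forget _ _ (forget AddCommGrpCat.{u}),
    isSheaf_iff_isSheaf_of_type] at hF
  have h := hF (Sieve.generate (Presieve.ofArrows V fun i => homOfLE (hV.subset i)))
    ⟨ι, inferInstance, V, hV, fun i => Sieve.le_generate _ _ _ (Presieve.ofArrows.mk i)⟩
  rw [← Presieve.isSheafFor_iff_generate, Presieve.isSheafFor_arrows_iff] at h
  refine h s fun i j W f g _ => ?_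
  have hW : W ⊆ V i ∩ V j := Set.subset_inter (leOfHom f) (leOfHom g)
  have := congrArg (res F.obj hW) (hs i j)
  rw [res_res, res_res] at this
  exact this

lemma eq_of_isCoarseCover (F : Sheaf (coarseTopology X) AddCommGrpCat.{u}) {ι : Type} [Finite ι]
    {U : Set X} {V : ι → Set X} (hV : IsCoarseCover U V) {s t : F.obj.obj (op U)}
    (h : ∀ i, res F.obj (hV.subset i) s = res F.obj (hV.subset i) t) : s = t :=
  (existsUnique_glue F hV (fun i => res F.obj (hV.subset i) t) fun i j => by
    rw [res_res, res_res]).unique h fun _ => rfl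

lemma exists_glue_pair (F : Sheaf (coarseTopology X) AddCommGrpCat.{u}) {U V W : Set X}
    (hV : IsCoarseCover U fun b : Bool => bif b then V else W)
    (s : F.obj.obj (op V)) (t : F.obj.obj (op W))
    (hst : res F.obj (Set.inter_subset_left : V ∩ W ⊆ V) s = res F.obj Set.inter_subset_right t) :
    ∃ r : F.obj.obj (op U), res F.obj (hV.subset true) r = s ∧
      res F.obj (hV.subset false) r = t := by
  obtain ⟨r, hr, -⟩ := existsUnique_glue F hV
    (fun b => match b with | true => s | false => t) fun i j => by
      rcases i with - | - <;> rcases j with - | -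
      · rfl
      · have h : W ∩ V ⊆ V ∩ W := fun x hx => ⟨hx.2, hx.1⟩
        have := congrArg (res F.obj h) hst
        rw [res_res, res_res] at this
        exact this.symm
      · exact hst
      · rfl
  exact ⟨r, hr true, hr false⟩

/-- A section which is locally in the image of a morphism with flabby kernel is in the image. -/
lemma exists_app_eq {F G : Sheaf (coarseTopology X) AddCommGrpCat.{u}} (f : F ⟶ G)
    (hf : ∀ ⦃U V : Set X⦄ (h : U ⊆ V) (k : F.obj.obj (op U)), f.hom.app (op U) k = 0 →
      ∃ k' : F.obj.obj (op V), f.hom.app (op V) k' = 0 ∧ res F.obj h k' = k)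
    {U : Set X} (s : G.obj.obj (op U)) (hs : Presheaf.imageSieve f.hom s ∈ coarseTopology X U) :
    ∃ t, f.hom.app (op U) t = s := by
  obtain ⟨ι, hι, V, hV, hVs⟩ := hs
  -- The induction property must make sense for every subset `W`, so it speaks of lifts over `U ∩
  -- W`.
  suffices h : ∃ t, f.hom.app (op (U ∩ U)) t = res G.obj Set.inter_subset_left s by
    obtain ⟨t, ht⟩ := h
    refine ⟨res F.obj (Set.subset_inter subset_rfl subset_rfl) t, ?_⟩
    rw [app_res, ht, res_res, res_self]
  refine hV.induction
    (P := fun W => ∃ t, f.hom.app (op (U ∩ W)) t = res G.obj Set.inter_subset_left s)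
    ?_ ?_ ?_ ?_
  · rintro W W' h ⟨t, ht⟩
    refine ⟨res F.obj (Set.inter_subset_inter_right U h) t, ?_⟩
    rw [app_res, ht, res_res]
  · intro W hW
    exact ⟨0, eq_of_isCoarseCover G
      (isCoarseCover_empty (hW.subset Set.inter_subset_right)) fun i => i.elim⟩
  · rintro W W₁ W₂ hc ⟨t₁, ht₁⟩ ⟨t₂, ht₂⟩
    have hc' : IsCoarseCover (U ∩ W)
        fun b : Bool => bif b then W₁ ∩ (U ∩ W) else W₂ ∩ (U ∩ W) := by
      convert hc.inter (Set.inter_subset_right : U ∩ W ⊆ W) using 2 with b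
      cases b <;> rfl
    have h₁ : W₁ ∩ (U ∩ W) ⊆ U ∩ W₁ := fun x hx => ⟨hx.2.1, hx.1⟩
    have h₂ : W₂ ∩ (U ∩ W) ⊆ U ∩ W₂ := fun x hx => ⟨hx.2.1, hx.1⟩
    -- On the overlap the two lifts differ by a section of the kernel. It extends to the first
    -- piece, and subtracting the extension there makes the lifts agree.
    obtain ⟨k, hk, hkt⟩ := hf
      (Set.inter_subset_left : W₁ ∩ (U ∩ W) ∩ (W₂ ∩ (U ∩ W)) ⊆ W₁ ∩ (U ∩ W))
      (res F.obj (Set.inter_subset_left.trans h₁) t₁ -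
        res F.obj (Set.inter_subset_right.trans h₂) t₂) (by
        rw [map_sub, app_res, app_res, ht₁, ht₂, res_res, res_res, sub_self])
    obtain ⟨t, htt₁, htt₂⟩ := exists_glue_pair F hc' (res F.obj h₁ t₁ - k) (res F.obj h₂ t₂) (by
      rw [map_sub, hkt, res_res, res_res]
      abel)
    refine ⟨t, eq_of_isCoarseCover G hc' fun b => ?_⟩
    rw [← app_res, res_res]
    cases b
    · refine (congrArg (f.hom.app _) htt₂).trans ?_
      rw [app_res, ht₂, res_res]
    · refine (congrArg (f.hom.app (op (W₁ ∩ (U ∩ W)))) htt₁).trans ?_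
      rw [map_sub, hk, sub_zero, app_res, ht₁, res_res]
  · intro i
    obtain ⟨t, ht⟩ := hVs i
    refine ⟨res F.obj Set.inter_subset_right t, ?_⟩
    rw [app_res, ht]
    exact res_res G.obj (hV.subset i) Set.inter_subset_right s

end Sections
-- Mapping cones in an abelian category
section Cone

open Limits

variable {𝒞 : Type*} [Category* 𝒞] [Abelian 𝒞]

/-- Exactness of the mapping cone of a morphism of complexes, where both complexes are exact. -/
lemma exact_cone {G₁ G₂ G₃ I₀ I₁ I₂ : 𝒞} {d₁ : G₁ ⟶ G₂} {d₂ : G₂ ⟶ G₃} {e₀ : I₀ ⟶ I₁}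
    {e₁ : I₁ ⟶ I₂} {φ₁ : G₁ ⟶ I₁} {φ₂ : G₂ ⟶ I₂} (hd : d₁ ≫ d₂ = 0) (he : e₀ ≫ e₁ = 0)
    (hG : (ShortComplex.mk d₁ d₂ hd).Exact) (hI : (ShortComplex.mk e₀ e₁ he).Exact)
    (comm : φ₁ ≫ e₁ = d₁ ≫ φ₂)
    (w : biprod.desc (biprod.lift d₁ φ₁) (biprod.lift 0 (-e₀)) ≫
      biprod.desc (biprod.lift d₂ φ₂) (biprod.lift 0 (-e₁)) = 0) :
    (ShortComplex.mk _ _ w).Exact := by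
  rw [ShortComplex.exact_iff_exact_up_to_refinements] at hG hI ⊢
  intro T x hx
  dsimp at x hx hG hI ⊢
  obtain ⟨a, b, rfl⟩ : ∃ a b, x = biprod.lift a b := ⟨x ≫ biprod.fst, x ≫ biprod.snd, by
    ext <;> simp⟩
  have ha : a ≫ d₂ = 0 := by simpa [biprod.lift_desc] using hx =≫ biprod.fst
  have hab : a ≫ φ₂ = b ≫ e₁ := by
    have := hx =≫ biprod.snd
    simp [biprod.lift_desc] at this
    exact add_neg_eq_zero.1 this
  obtain ⟨T₁, π₁, _, g, hg⟩ := hG a ha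
  -- The lift `g` of `a` may miss `b` in the second component. The discrepancy is a cycle for `e₁`,
  -- so locally a boundary of some `c`, which corrects it.
  obtain ⟨T₂, π₂, _, c, hc⟩ := hI (g ≫ φ₁ - π₁ ≫ b) (by
    rw [Preadditive.sub_comp, Category.assoc, comm, ← Category.assoc, ← hg, Category.assoc, hab,
      Category.assoc, sub_self])
  refine ⟨T₂, π₂ ≫ π₁, inferInstance, biprod.lift (π₂ ≫ g) c, ?_⟩
  ext
  · simp [biprod.lift_desc, hg]
  · simp [biprod.lift_desc, ← hc]

/-- Here the correction `c` takes values in `F`, and it is absorbed by replacing `g` with `g - c ≫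
ε`: this leaves the first component unchanged and shifts the second by `c ≫ η`. -/
lemma exact_cone_zero {F G₀ G₁ G₂ I₀ I₁ : 𝒞} {ε : F ⟶ G₀} {η : F ⟶ I₀} {d₀ : G₀ ⟶ G₁}
    {d₁ : G₁ ⟶ G₂} {e₀ : I₀ ⟶ I₁} {φ₀ : G₀ ⟶ I₀} {φ₁ : G₁ ⟶ I₁} (hε : ε ≫ d₀ = 0)
    (hd : d₀ ≫ d₁ = 0) (hη : η ≫ e₀ = 0)
    (hG : (ShortComplex.mk d₀ d₁ hd).Exact) (hI : (ShortComplex.mk η e₀ hη).Exact)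
    (comm : φ₀ ≫ e₀ = d₀ ≫ φ₁) (hφ : ε ≫ φ₀ = η)
    (w : biprod.lift d₀ φ₀ ≫ biprod.desc (biprod.lift d₁ φ₁) (biprod.lift 0 (-e₀)) = 0) :
    (ShortComplex.mk _ _ w).Exact := by
  rw [ShortComplex.exact_iff_exact_up_to_refinements] at hG hI ⊢
  intro T x hx
  dsimp at x hx hG hI ⊢
  obtain ⟨a, b, rfl⟩ : ∃ a b, x = biprod.lift a b := ⟨x ≫ biprod.fst, x ≫ biprod.snd, by
    ext <;> simp⟩
  have ha : a ≫ d₁ = 0 := by simpa [biprod.lift_desc] using hx =≫ biprod.fst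
  have hab : a ≫ φ₁ = b ≫ e₀ := by
    have := hx =≫ biprod.snd
    simp [biprod.lift_desc] at this
    exact add_neg_eq_zero.1 this
  obtain ⟨T₁, π₁, _, g, hg⟩ := hG a ha
  obtain ⟨T₂, π₂, _, c, hc⟩ := hI (g ≫ φ₀ - π₁ ≫ b) (by
    rw [Preadditive.sub_comp, Category.assoc, comm, ← Category.assoc, ← hg, Category.assoc, hab,
      Category.assoc, sub_self])
  refine ⟨T₂, π₂ ≫ π₁, inferInstance, π₂ ≫ g - c ≫ ε, ?_⟩
  ext
  · simp [hε, hg]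
  · simp [hφ, ← hc]

/-- The kernel of `d₀` comes from `F`, where `φ₀` restricts to the monomorphism `η`. -/
lemma mono_cone_zero {F G₀ G₁ I₀ : 𝒞} {ε : F ⟶ G₀} {η : F ⟶ I₀} [Mono η] {d₀ : G₀ ⟶ G₁}
    {φ₀ : G₀ ⟶ I₀} (hε : ε ≫ d₀ = 0) (hG : (ShortComplex.mk ε d₀ hε).Exact) (hφ : ε ≫ φ₀ = η) :
    Mono (biprod.lift d₀ φ₀) := by
  rw [ShortComplex.exact_iff_exact_up_to_refinements] at hG
  rw [Preadditive.mono_iff_cancel_zero]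
  intro T x hx
  have h₁ : x ≫ d₀ = 0 := by simpa using hx =≫ biprod.fst
  have h₂ : x ≫ φ₀ = 0 := by simpa using hx =≫ biprod.snd
  obtain ⟨T₁, π, _, f, hf⟩ := hG x h₁
  dsimp at f hf
  have : f ≫ η = 0 := by
    rw [← hφ, ← Category.assoc, ← hf, Category.assoc, h₂, comp_zero]
  rw [← cancel_epi π, hf, zero_of_comp_mono η this, zero_comp, comp_zero]

lemma cone_d_comp_d {G₁ G₂ G₃ I₀ I₁ I₂ : 𝒞} {d₁ : G₁ ⟶ G₂} {d₂ : G₂ ⟶ G₃} {e₀ : I₀ ⟶ I₁}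
    {e₁ : I₁ ⟶ I₂} {φ₁ : G₁ ⟶ I₁} {φ₂ : G₂ ⟶ I₂} (hd : d₁ ≫ d₂ = 0) (he : e₀ ≫ e₁ = 0)
    (comm : φ₁ ≫ e₁ = d₁ ≫ φ₂) :
    biprod.desc (biprod.lift d₁ φ₁) (biprod.lift 0 (-e₀)) ≫
      biprod.desc (biprod.lift d₂ φ₂) (biprod.lift 0 (-e₁)) = 0 := by
  ext <;> simp [biprod.lift_desc, hd, he, comm]

lemma cone_zero_d_comp_d {G₀ G₁ G₂ I₀ I₁ : 𝒞} {d₀ : G₀ ⟶ G₁} {d₁ : G₁ ⟶ G₂} {e₀ : I₀ ⟶ I₁}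
    {φ₀ : G₀ ⟶ I₀} {φ₁ : G₁ ⟶ I₁} (hd : d₀ ≫ d₁ = 0) (comm : φ₀ ≫ e₀ = d₀ ≫ φ₁) :
    biprod.lift d₀ φ₀ ≫ biprod.desc (biprod.lift d₁ φ₁) (biprod.lift 0 (-e₀)) = 0 := by
  ext <;> simp [biprod.lift_desc, hd, comm]

lemma cone_d_fst {G₁ G₂ I₀ I₁ : 𝒞} (d : G₁ ⟶ G₂) (e : I₀ ⟶ I₁) (φ : G₁ ⟶ I₁) :
    biprod.desc (biprod.lift d φ) (biprod.lift 0 (-e)) ≫ biprod.fst = biprod.fst ≫ d := by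
  ext <;> simp

lemma cone_d_snd {G₁ G₂ I₀ I₁ : 𝒞} (d : G₁ ⟶ G₂) (e : I₀ ⟶ I₁) (φ : G₁ ⟶ I₁) :
    biprod.desc (biprod.lift d φ) (biprod.lift 0 (-e)) ≫ biprod.snd =
      biprod.fst ≫ φ - biprod.snd ≫ e := by
  ext <;> simp

/-- A resolution maps to any complex of injective objects. -/
lemma exists_comparison {F : 𝒞} {G I : ℕ → 𝒞} [∀ n, Injective (I n)] {ε : F ⟶ G 0} [Mono ε]
    {d : ∀ n, G n ⟶ G (n + 1)} (hε : ε ≫ d 0 = 0) (hd : ∀ n, d n ≫ d (n + 1) = 0)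
    (hG₀ : (ShortComplex.mk ε (d 0) hε).Exact)
    (hG : ∀ n, (ShortComplex.mk (d n) (d (n + 1)) (hd n)).Exact)
    {η : F ⟶ I 0} {e : ∀ n, I n ⟶ I (n + 1)} (hη : η ≫ e 0 = 0)
    (he : ∀ n, e n ≫ e (n + 1) = 0) :
    ∃ φ : ∀ n, G n ⟶ I n, ε ≫ φ 0 = η ∧ ∀ n, φ n ≫ e n = d n ≫ φ (n + 1) := by
  -- Extending the map by one degree needs the preceding commutative square, so the recursion
  -- carries two consecutive components together with their square.
  let P : ℕ → Type _ := fun n =>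
    {p : (G n ⟶ I n) × (G (n + 1) ⟶ I (n + 1)) // p.1 ≫ e n = d n ≫ p.2}
  have h₀ : Injective.factorThru η ε ≫ e 0 =
      d 0 ≫ hG₀.descToInjective (Injective.factorThru η ε ≫ e 0) (by
        dsimp
        rw [← Category.assoc, Injective.comp_factorThru, hη]) :=
    (hG₀.comp_descToInjective _ _).symm
  have next : ∀ n (p : P n), ∃ p' : P (n + 1), p'.1.1 = p.1.2 := fun n p =>
    ⟨⟨(p.1.2, (hG n).descToInjective (p.1.2 ≫ e (n + 1)) (by
      dsimp
      rw [← Category.assoc, ← p.2, Category.assoc, he, comp_zero])),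
      ((hG n).comp_descToInjective _ _).symm⟩, rfl⟩
  choose f hf using next
  let s : ∀ n, P n := fun n => Nat.rec ⟨(_, _), h₀⟩ f n
  refine ⟨fun n => (s n).1.1, Injective.comp_factorThru _ _, fun n => ?_⟩
  have : (s (n + 1)).1.1 = (s n).1.2 := hf n (s n)
  exact (s n).2.trans (congrArg (d n ≫ ·) this.symm)

end Cone

/-! ### Flabby sheaves and exactness on sections -/

section Flabby

open Limits Opposite

variable {X : Type u} [MetricSpace X]

/-- By induction, sections of the kernel of `d n` extend to larger sets. For `n = 0` the kernel is
zero. Afterwards such a section is the image of a section of the flabby sheaf before it, which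
extends. Cycles then lift by `exists_app_eq`. -/
lemma exact_sections_of_isFlabby {C : ℕ → Sheaf (coarseTopology X) AddCommGrpCat.{u}}
    (hC : ∀ n, IsFlabby (C n)) {d : ∀ n, C n ⟶ C (n + 1)} [Mono (d 0)]
    (hd : ∀ n, d n ≫ d (n + 1) = 0)
    (hex : ∀ n, (ShortComplex.mk (d n) (d (n + 1)) (hd n)).Exact) (n : ℕ) (U : Set X)
    (s : (C (n + 1)).obj.obj (op U)) (hs : (d (n + 1)).hom.app (op U) s = 0) :
    ∃ t, (d n).hom.app (op U) t = s := by
  have hdd : ∀ n U t, (d (n + 1)).hom.app (op U) ((d n).hom.app (op U) t) = 0 := fun n U t =>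
    ConcreteCategory.congr_hom (congrArg (fun f => f.hom.app (op U)) (hd n)) t
  have lift : ∀ n, (∀ ⦃U V : Set X⦄ (h : U ⊆ V) (k : (C n).obj.obj (op U)),
      (d n).hom.app (op U) k = 0 → ∃ k' : (C n).obj.obj (op V),
        (d n).hom.app (op V) k' = 0 ∧ res (C n).obj h k' = k) →
      ∀ (U : Set X) (s : (C (n + 1)).obj.obj (op U)), (d (n + 1)).hom.app (op U) s = 0 →
        ∃ t, (d n).hom.app (op U) t = s := fun n hn U s hs =>
    exists_app_eq (d n) hn s ((exact_iff_imageSieve_mem _).1 (hex n) U s hs)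
  refine lift n ?_ U s hs
  clear s hs U
  induction n with
  | zero =>
    intro U V h k hk
    refine ⟨0, map_zero _, ?_⟩
    rw [map_zero]
    exact (injective_app_of_mono (d 0) (op U) (hk.trans (map_zero _).symm)).symm
  | succ n ih =>
    intro U V h k hk
    obtain ⟨t, rfl⟩ := lift n ih U k hk
    obtain ⟨t', rfl⟩ := hC n h t
    exact ⟨(d n).hom.app (op V) t', hdd n V t', (app_res (d n).hom h t').symm⟩

section Biprod

variable (F G : Sheaf (coarseTopology X) AddCommGrpCat.{u}) (U : Set X)

lemma biprod_app_total (x : (F ⊞ G).obj.obj (op U)) :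
    (biprod.inl : F ⟶ F ⊞ G).hom.app (op U) ((biprod.fst : F ⊞ G ⟶ F).hom.app (op U) x) +
      (biprod.inr : G ⟶ F ⊞ G).hom.app (op U) ((biprod.snd : F ⊞ G ⟶ G).hom.app (op U) x) = x :=
  ConcreteCategory.congr_hom
    (congrArg (fun f => f.hom.app (op U)) (biprod.total (X := F) (Y := G))) x

end Biprod

lemma comp_app {F G H : Sheaf (coarseTopology X) AddCommGrpCat.{u}} {f : F ⟶ G} {g : G ⟶ H}
    {h : F ⟶ H} (w : f ≫ g = h) (U : Set X) (x : F.obj.obj (op U)) :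
    g.hom.app (op U) (f.hom.app (op U) x) = h.hom.app (op U) x :=
  ConcreteCategory.congr_hom (congrArg (fun f => f.hom.app (op U)) w) x

lemma IsFlabby.biprod {F G : Sheaf (coarseTopology X) AddCommGrpCat.{u}} (hF : IsFlabby F)
    (hG : IsFlabby G) : IsFlabby (F ⊞ G) := by
  intro U V h x
  obtain ⟨a, ha⟩ := hF h ((biprod.fst : F ⊞ G ⟶ F).hom.app (op U) x)
  obtain ⟨b, hb⟩ := hG h ((biprod.snd : F ⊞ G ⟶ G).hom.app (op U) x)
  refine ⟨(biprod.inl : F ⟶ F ⊞ G).hom.app (op V) a +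
    (biprod.inr : G ⟶ F ⊞ G).hom.app (op V) b, ?_⟩
  change res _ h _ = _
  rw [map_add, ← app_res, ← app_res]
  conv_rhs => rw [← biprod_app_total F G U x, ← ha, ← hb]
  rfl

/-- Sections over `U` are maps from the free abelian presheaf on `yoneda.obj U`. Restriction along
`i` is precomposition with a monomorphism, and maps to an injective object extend along it. -/
lemma surjective_map_of_injective {C : Type u} [SmallCategory C] (P : Cᵒᵖ ⥤ AddCommGrpCat.{u})
    [Injective P] {U V : C} (i : U ⟶ V) [Mono i] : Function.Surjective (P.map i.op) := by
  intro s
  let adj := AddCommGrpCat.adj.{u}.whiskerRight Cᵒᵖ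
  let j := ((Functor.whiskeringRight Cᵒᵖ _ _).obj AddCommGrpCat.free.{u}).map (yoneda.map i)
  have hj : Mono j := by
    have (W : Cᵒᵖ) : Mono (j.app W) :=
      inferInstanceAs (Mono (AddCommGrpCat.free.map ((yoneda.map i).app W)))
    exact NatTrans.mono_of_mono_app j
  let f := (adj.homEquiv (yoneda.obj U) P).symm
    (yonedaEquiv (F := P ⋙ forget AddCommGrpCat.{u}).symm s)
  have hf : j ≫ Injective.factorThru f j = f := Injective.comp_factorThru f j
  have h := congrArg (adj.homEquiv (yoneda.obj U) P) hf
  rw [Equiv.apply_symm_apply, Adjunction.homEquiv_naturality_left] at h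
  have h' := congrArg (yonedaEquiv (F := P ⋙ forget AddCommGrpCat.{u})) h
  rw [Equiv.apply_symm_apply] at h'
  exact ⟨yonedaEquiv (F := P ⋙ forget AddCommGrpCat.{u})
    (adj.homEquiv (yoneda.obj V) P (Injective.factorThru f j)), (yonedaEquiv_naturality _ _).trans h'⟩

/-- Sheafification is exact and left adjoint to the inclusion, so an injective sheaf is an injective
presheaf. -/
lemma isFlabby_of_injective (I : Sheaf (coarseTopology X) AddCommGrpCat.{u}) [Injective I] :
    IsFlabby I := by
  have hI : Injective I.obj := Injective.injective_of_adjoint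
    (sheafificationAdjunction (coarseTopology X) AddCommGrpCat.{u}) I
  intro U V h
  have hm : Mono (homOfLE h) := ⟨fun _ _ _ => Subsingleton.elim _ _⟩
  exact surjective_map_of_injective I.obj (homOfLE h)

end Flabby
-- The cone of two flabby resolutions on sections
section Comparison

open Limits Opposite

/-- A morphism between two flabby resolutions induces a quasi-isomorphism on sections: in the mapping
cone of the map on sections, all cycles are boundaries. -/
lemma exact_sections_cone {X : Type u} [MetricSpace X]
    {F : Sheaf (coarseTopology X) AddCommGrpCat.{u}}
    {G I : ℕ → Sheaf (coarseTopology X) AddCommGrpCat.{u}} {ε : F ⟶ G 0}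
    {d : ∀ n, G n ⟶ G (n + 1)} (hG : IsFlabbyResolution ε d) {η : F ⟶ I 0} [Mono η]
    {e : ∀ n, I n ⟶ I (n + 1)} (hI : ∀ n, IsFlabby (I n)) (hη : η ≫ e 0 = 0)
    (he : ∀ n, e n ≫ e (n + 1) = 0) (hI₀ : (ShortComplex.mk η (e 0) hη).Exact)
    (hIe : ∀ n, (ShortComplex.mk (e n) (e (n + 1)) (he n)).Exact)
    {φ : ∀ n, G n ⟶ I n} (hφ₀ : ε ≫ φ 0 = η) (hφ : ∀ n, φ n ≫ e n = d n ≫ φ (n + 1))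
    (U : Set X) :
    (∀ g, (d 0).hom.app (op U) g = 0 → (φ 0).hom.app (op U) g = 0 → g = 0) ∧
    (∀ g i, (d 1).hom.app (op U) g = 0 → (φ 1).hom.app (op U) g = (e 0).hom.app (op U) i →
      ∃ g', (d 0).hom.app (op U) g' = g ∧ (φ 0).hom.app (op U) g' = i) ∧
    (∀ n g i, (d (n + 2)).hom.app (op U) g = 0 →
      (φ (n + 2)).hom.app (op U) g = (e (n + 1)).hom.app (op U) i →
      ∃ g' i', (d (n + 1)).hom.app (op U) g' = g ∧
        (φ (n + 1)).hom.app (op U) g' - (e n).hom.app (op U) i' = i) := by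
  obtain ⟨hε, hε'⟩ := hG.exact_zero
  choose hd hd' using hG.exact_succ
  let C : ℕ → Sheaf (coarseTopology X) AddCommGrpCat.{u} := fun n =>
    match n with
    | 0 => G 0
    | n + 1 => G (n + 1) ⊞ I n
  let D : ∀ n, C n ⟶ C (n + 1) := fun n =>
    match n with
    | 0 => biprod.lift (d 0) (φ 0)
    | n + 1 => biprod.desc (biprod.lift (d (n + 1)) (φ (n + 1))) (biprod.lift 0 (-e n))
  have hC : ∀ n, IsFlabby (C n) := fun n =>
    match n with
    | 0 => hG.flabby 0
    | n + 1 => (hG.flabby (n + 1)).biprod (hI n)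
  have hD : ∀ n, D n ≫ D (n + 1) = 0 := fun n =>
    match n with
    | 0 => cone_zero_d_comp_d (hd 0) (hφ 0)
    | n + 1 => cone_d_comp_d (hd (n + 1)) (he n) (hφ (n + 1))
  have hmono : Mono (D 0) := mono_cone_zero hε hε' hφ₀
  have hDex : ∀ n, (ShortComplex.mk (D n) (D (n + 1)) (hD n)).Exact := fun n =>
    match n with
    | 0 => exact_cone_zero hε (hd 0) hη (hd' 0) hI₀ (hφ 0) hφ₀ _
    | n + 1 => exact_cone (hd (n + 1)) (he n) (hd' (n + 1)) (hIe n) (hφ (n + 1)) _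
  have key := exact_sections_of_isFlabby hC hD hDex
  have ext : ∀ n (x y : (G (n + 1) ⊞ I n).obj.obj (op U)),
      (biprod.fst : G (n + 1) ⊞ I n ⟶ _).hom.app (op U) x =
        (biprod.fst : G (n + 1) ⊞ I n ⟶ _).hom.app (op U) y →
      (biprod.snd : G (n + 1) ⊞ I n ⟶ _).hom.app (op U) x =
        (biprod.snd : G (n + 1) ⊞ I n ⟶ _).hom.app (op U) y → x = y := by
    intro n x y h h'
    rw [← biprod_app_total _ _ U x, ← biprod_app_total _ _ U y, h, h']
  have pair : ∀ n (g : (G (n + 1)).obj.obj (op U)) (i : (I n).obj.obj (op U)),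
      ∃ x : (G (n + 1) ⊞ I n).obj.obj (op U),
        (biprod.fst : G (n + 1) ⊞ I n ⟶ _).hom.app (op U) x = g ∧
        (biprod.snd : G (n + 1) ⊞ I n ⟶ _).hom.app (op U) x = i := by
    intro n g i
    refine ⟨(biprod.inl : G (n + 1) ⟶ G (n + 1) ⊞ I n).hom.app (op U) g +
      (biprod.inr : I n ⟶ G (n + 1) ⊞ I n).hom.app (op U) i, ?_, ?_⟩
    · rw [map_add, comp_app biprod.inl_fst, comp_app biprod.inr_fst]
      exact add_zero g
    · rw [map_add, comp_app biprod.inl_snd, comp_app biprod.inr_snd]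
      exact zero_add i
  have fst₀ : ∀ g, (biprod.fst : G 1 ⊞ I 0 ⟶ _).hom.app (op U) ((D 0).hom.app (op U) g) =
      (d 0).hom.app (op U) g := comp_app (biprod.lift_fst _ _) U
  have snd₀ : ∀ g, (biprod.snd : G 1 ⊞ I 0 ⟶ _).hom.app (op U) ((D 0).hom.app (op U) g) =
      (φ 0).hom.app (op U) g := comp_app (biprod.lift_snd _ _) U
  have fst : ∀ n (x : (G (n + 1) ⊞ I n).obj.obj (op U)),
      (biprod.fst : G (n + 2) ⊞ I (n + 1) ⟶ _).hom.app (op U) ((D (n + 1)).hom.app (op U) x) =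
      (d (n + 1)).hom.app (op U) ((biprod.fst : G (n + 1) ⊞ I n ⟶ _).hom.app (op U) x) := fun n =>
    comp_app (cone_d_fst (d (n + 1)) (e n) (φ (n + 1))) U
  have snd : ∀ n (x : (G (n + 1) ⊞ I n).obj.obj (op U)),
      (biprod.snd : G (n + 2) ⊞ I (n + 1) ⟶ _).hom.app (op U) ((D (n + 1)).hom.app (op U) x) =
      (φ (n + 1)).hom.app (op U) ((biprod.fst : G (n + 1) ⊞ I n ⟶ _).hom.app (op U) x) -
      (e n).hom.app (op U) ((biprod.snd : G (n + 1) ⊞ I n ⟶ _).hom.app (op U) x) := fun n =>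
    comp_app (cone_d_snd (d (n + 1)) (e n) (φ (n + 1))) U
  have cycle : ∀ n (x : (G (n + 1) ⊞ I n).obj.obj (op U)),
      (d (n + 1)).hom.app (op U) ((biprod.fst : G (n + 1) ⊞ I n ⟶ _).hom.app (op U) x) = 0 →
      (φ (n + 1)).hom.app (op U) ((biprod.fst : G (n + 1) ⊞ I n ⟶ _).hom.app (op U) x) =
        (e n).hom.app (op U) ((biprod.snd : G (n + 1) ⊞ I n ⟶ _).hom.app (op U) x) →
      ∃ t, (D n).hom.app (op U) t = x := by
    intro n x h h'
    refine key n U x (ext (n + 1) _ _ ?_ ?_)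
    · rw [fst, h, map_zero]
    · rw [snd, h', sub_self, map_zero]
  -- The three cases are the cone at `G 0`, at `G 1 ⊞ I 0`, whose predecessor has no `I` summand,
  -- and at the later terms.
  refine ⟨fun g hg hg' => ?_, fun g i hg hg' => ?_, fun n g i hg hg' => ?_⟩
  · refine injective_app_of_mono (D 0) (op U) (ext 0 _ _ ?_ ?_)
    · rw [map_zero, map_zero, fst₀, hg]
    · rw [map_zero, map_zero, snd₀, hg']
  · obtain ⟨x, rfl, rfl⟩ := pair 0 g i
    obtain ⟨t, rfl⟩ := cycle 0 x hg hg'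
    exact ⟨t, (fst₀ t).symm, (snd₀ t).symm⟩
  · obtain ⟨x, rfl, rfl⟩ := pair (n + 1) g i
    obtain ⟨t, rfl⟩ := cycle (n + 1) x hg hg'
    exact ⟨_, _, (fst n t).symm, (snd n t).symm⟩

end Comparison

/-! ### Elementwise criteria for quasi-isomorphisms -/

section Homology

lemma isIso_homologyMap_ab {S T : ShortComplex AddCommGrpCat.{u}} (φ : S ⟶ T)
    (hinj : ∀ x, S.g x = 0 → ∀ y, φ.τ₂ x = T.f y → ∃ z, S.f z = x)
    (hsurj : ∀ y, T.g y = 0 → ∃ x, S.g x = 0 ∧ ∃ z, φ.τ₂ x + T.f z = y) :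
    IsIso (ShortComplex.homologyMap φ) := by
  have cyc : ∀ (R : ShortComplex AddCommGrpCat.{u}) (x : R.X₂), R.g x = 0 →
      ∃ c, R.iCycles c = x := fun R x hx =>
    (ShortComplex.ab_exact_iff (ShortComplex.mk R.iCycles R.g R.iCycles_g)).1
      (ShortComplex.exact_of_f_is_kernel _ R.cyclesIsKernel) x hx
  have iinj : ∀ R : ShortComplex AddCommGrpCat.{u}, Function.Injective R.iCycles := fun R =>
    (AddCommGrpCat.mono_iff_injective _).1 inferInstance
  have psurj : ∀ R : ShortComplex AddCommGrpCat.{u}, Function.Surjective R.homologyπ := fun R =>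
    (AddCommGrpCat.epi_iff_surjective _).1 inferInstance
  have pker : ∀ (R : ShortComplex AddCommGrpCat.{u}) (c : R.cycles), R.homologyπ c = 0 →
      ∃ z, R.f z = R.iCycles c := by
    intro R c hc
    obtain ⟨z, rfl⟩ := (ShortComplex.ab_exact_iff
      (ShortComplex.mk R.toCycles R.homologyπ R.toCycles_comp_homologyπ)).1
      (ShortComplex.exact_of_g_is_cokernel _ R.homologyIsCokernel) c hc
    exact ⟨z, (ConcreteCategory.congr_hom R.toCycles_i z).symm⟩
  have pzero : ∀ (R : ShortComplex AddCommGrpCat.{u}) (z : R.X₁), R.homologyπ (R.toCycles z) = 0 :=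
    fun R z => ConcreteCategory.congr_hom R.toCycles_comp_homologyπ z
  have nat : ∀ c, ShortComplex.homologyMap φ (S.homologyπ c) =
      T.homologyπ (ShortComplex.cyclesMap φ c) := fun c =>
    ConcreteCategory.congr_hom (ShortComplex.homologyπ_naturality φ) c
  have nat' : ∀ c, T.iCycles (ShortComplex.cyclesMap φ c) = φ.τ₂ (S.iCycles c) := fun c =>
    ConcreteCategory.congr_hom (ShortComplex.cyclesMap_i φ) c
  have hmono : Mono (ShortComplex.homologyMap φ) := by
    rw [AddCommGrpCat.mono_iff_injective, injective_iff_map_eq_zero]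
    intro h hh
    obtain ⟨c, rfl⟩ := psurj S h
    rw [nat] at hh
    obtain ⟨y, hy⟩ := pker T _ hh
    obtain ⟨z, hz⟩ := hinj (S.iCycles c) (ConcreteCategory.congr_hom S.iCycles_g c) y
      ((nat' c).symm.trans hy.symm)
    have : c = S.toCycles z := iinj S (hz.symm.trans
      (ConcreteCategory.congr_hom S.toCycles_i z).symm)
    rw [this, pzero]
  have hepi : Epi (ShortComplex.homologyMap φ) := by
    rw [AddCommGrpCat.epi_iff_surjective]
    intro h
    obtain ⟨c, rfl⟩ := psurj T h
    obtain ⟨x, hx, z, hz⟩ := hsurj (T.iCycles c) (ConcreteCategory.congr_hom T.iCycles_g c)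
    obtain ⟨b, rfl⟩ := cyc S x hx
    refine ⟨S.homologyπ b, ?_⟩
    have : c = ShortComplex.cyclesMap φ b + T.toCycles z := iinj T (by
      rw [map_add, nat', ← hz]
      exact congrArg _ (ConcreteCategory.congr_hom T.toCycles_i z).symm)
    rw [nat, this, map_add, pzero, add_zero]
  exact isIso_of_mono_of_epi _

lemma isIso_homologyMap {K L : CochainComplex AddCommGrpCat.{u} ℕ} (φ : K ⟶ L)
    (h₀ : ∀ x, K.d 0 1 x = 0 → φ.f 0 x = 0 → x = 0)
    (hinj : ∀ n x, K.d (n + 1) (n + 2) x = 0 → ∀ y, φ.f (n + 1) x = L.d n (n + 1) y →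
      ∃ z, K.d n (n + 1) z = x)
    (h₀' : ∀ y, L.d 0 1 y = 0 → ∃ x, K.d 0 1 x = 0 ∧ φ.f 0 x = y)
    (hsurj : ∀ n y, L.d (n + 1) (n + 2) y = 0 → ∃ x, K.d (n + 1) (n + 2) x = 0 ∧
      ∃ z, φ.f (n + 1) x + L.d n (n + 1) z = y) (n : ℕ) :
    IsIso (HomologicalComplex.homologyMap φ n) := by
  obtain ⟨k, hk⟩ : ∃ k, (ComplexShape.up ℕ).next n = k := ⟨_, rfl⟩
  obtain ⟨i, hi⟩ : ∃ i, (ComplexShape.up ℕ).prev n = i := ⟨_, rfl⟩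
  have hk' := hk
  have hi' := hi
  rw [CochainComplex.next] at hk
  suffices h : (∀ x, K.d n k x = 0 → ∀ y, φ.f n x = L.d i n y → ∃ z, K.d i n z = x) ∧
      (∀ y, L.d n k y = 0 → ∃ x, K.d n k x = 0 ∧ ∃ z, φ.f n x + L.d i n z = y) by
    subst hk' hi'
    exact isIso_homologyMap_ab _ h.1 h.2
  subst hk
  cases n with
  | zero =>
    rw [CochainComplex.prev_nat_zero] at hi
    subst hi
    -- In degree 0 the predecessor index is 0 itself, and the differential there is zero, so there
    -- are no boundaries.
    have hL : ∀ y, L.d 0 0 y = 0 := fun y =>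
      ConcreteCategory.congr_hom (L.shape 0 0 (by simp)) y
    refine ⟨fun x hx y hxy => ⟨0, ?_⟩, fun y hy => ?_⟩
    · rw [map_zero, h₀ x hx (hxy.trans (hL y))]
    · obtain ⟨x, hx, rfl⟩ := h₀' y hy
      exact ⟨x, hx, 0, by rw [map_zero, add_zero]⟩
  | succ n =>
    rw [CochainComplex.prev_nat_succ] at hi
    subst hi
    exact ⟨hinj n, hsurj n⟩

end Homology

/-! ### Coarse cohomology as blocky cohomology -/

section Main

open Opposite

variable {X : Type u} [MetricSpace X] {A : Type u} [AddCommGroup A]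

variable (X A) in
/-- `CY_b^q(X, A)` as the sections of `CY_b^q(·, A)` over `X`. -/
def toUniv (q : ℕ) : CY X A q →+ CY (Set.univ : Set X) A q :=
  CY.pullback A (Z := (Set.univ : Set X)) Subtype.val (fun _ _ => rfl) q

lemma toUniv_injective (q : ℕ) : Function.Injective (toUniv X A q) := by
  rw [injective_iff_map_eq_zero]
  intro c hc
  obtain ⟨f, rfl⟩ := QuotientAddGroup.mk_surjective c
  have hf : NegligibleOn Set.univ f.1 := (cls_eq_zero_iff Set.univ f).1 hc
  refine (QuotientAddGroup.eq_zero_iff _).2 fun R _ k => ?_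
  obtain ⟨B, hB, h⟩ := hf R
  refine hB.subset ?_
  rintro _ ⟨x, ⟨hx, hxR⟩, rfl⟩
  exact h x (fun _ => trivial) hxR hx k

lemma toUniv_surjective (q : ℕ) : Function.Surjective (toUniv X A q) := fun c => by
  obtain ⟨f, rfl⟩ := cls_surjective (A := A) Set.univ q c
  exact ⟨QuotientAddGroup.mk f, rfl⟩

lemma toUniv_d (q : ℕ) (c : CY X A q) :
    toUniv X A (q + 1) (CY.d X A q c) = CY.d (Set.univ : Set X) A q (toUniv X A q c) :=
  CY.pullback_d A _ _ q c

lemma CYComplex_d (q : ℕ) :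
    (CYComplex X A).d q (q + 1) = AddCommGrpCat.ofHom (CY.d X A q) :=
  CochainComplex.of_d (fun q => AddCommGrpCat.of (CY X A q))
    (fun q => AddCommGrpCat.ofHom (CY.d X A q)) q

/-- Homology of the global sections of an injective resolution is the derived functor. The map `ψ`
into it is a quasi-isomorphism by exactness of the cone, and `toUniv` passes between `X` and its
total subset. -/
lemma nonempty_coarseCohomology_iso
    (h : ∀ q, Presheaf.IsSheaf (coarseTopology X) (CYPresheaf X A q))
    (hres : IsFlabbyResolution (G := fun q => ⟨CYPresheaf X A q, h q⟩)
      (augmentation (h 0)) (fun q => ObjectProperty.homMk (CYPresheafD X A q))) (q : ℕ) :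
    Nonempty (coarseCohomology (constSheaf X A) q ≅ HY X A q) := by
  let P := injectiveResolution (constSheaf X A)
  let I : ℕ → Sheaf (coarseTopology X) AddCommGrpCat.{u} := P.cocomplex.X
  let e : ∀ n, I n ⟶ I (n + 1) := fun n => P.cocomplex.d n (n + 1)
  let η : constSheaf X A ⟶ I 0 := P.ι.f 0
  have hmono : Mono η := inferInstanceAs (Mono (P.ι.f 0))
  have hinj : ∀ n, Injective (I n) := P.injective
  have hε := hres.mono
  obtain ⟨hd₀, hd₀'⟩ := hres.exact_zero
  choose hd hd' using hres.exact_succ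
  have he : ∀ n, e n ≫ e (n + 1) = 0 := fun n => P.cocomplex.d_comp_d _ _ _
  have hη : η ≫ e 0 = 0 := P.ι_f_zero_comp_complex_d
  obtain ⟨φ, hφ₀, hφ⟩ := exists_comparison hd₀ hd hd₀' hd' hη he
  obtain ⟨c₁, c₂, c₃⟩ := exact_sections_cone hres (fun n => isFlabby_of_injective (I n)) hη he
    P.exact₀ P.exact_succ hφ₀ hφ Set.univ
  let L := ((globalSections X).mapHomologicalComplex (ComplexShape.up ℕ)).obj P.cocomplex
  let ψ : CYComplex X A ⟶ L :=
    { f n := AddCommGrpCat.ofHom (toUniv X A n) ≫ (φ n).hom.app (op Set.univ)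
      comm' := by
        rintro i j rfl
        rw [CYComplex_d]
        ext c
        refine (comp_app (hφ i) Set.univ (toUniv X A i c)).trans ?_
        exact congrArg ((φ (i + 1)).hom.app (op Set.univ)) (toUniv_d i c).symm }
  have hψ : IsIso (HomologicalComplex.homologyMap ψ q) := by
    have d_eq : ∀ n (c : CY X A n), (CYComplex X A).d n (n + 1) c = CY.d X A n c := fun n c =>
      ConcreteCategory.congr_hom (CYComplex_d n) c
    have cyc : ∀ n (c : CY X A n), (CYComplex X A).d n (n + 1) c = 0 ↔
        CY.d (Set.univ : Set X) A n (toUniv X A n c) = 0 := fun n c => by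
      rw [← toUniv_d, map_eq_zero_iff _ (toUniv_injective (n + 1)), ← d_eq]
      rfl
    have lift : ∀ n (g : CY (Set.univ : Set X) A n), CY.d (Set.univ : Set X) A n g = 0 →
        ∃ c : CY X A n, (CYComplex X A).d n (n + 1) c = 0 ∧ toUniv X A n c = g := by
      intro n g hg
      obtain ⟨c, rfl⟩ := toUniv_surjective n g
      exact ⟨c, (cyc n c).2 hg, rfl⟩
    have bdry : ∀ n (c : CY X A (n + 1)) (g : CY (Set.univ : Set X) A n),
        CY.d (Set.univ : Set X) A n g = toUniv X A (n + 1) c →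
        ∃ z, (CYComplex X A).d n (n + 1) z = c := by
      intro n c g hg
      obtain ⟨z, rfl⟩ := toUniv_surjective n g
      refine ⟨z, (d_eq n z).trans (toUniv_injective _ ?_)⟩
      rw [toUniv_d, hg]
    refine isIso_homologyMap ψ ?_ ?_ ?_ ?_ q
    · intro x hx hx'
      refine toUniv_injective 0 ((c₁ _ ((cyc 0 x).1 hx) hx').trans (map_zero _).symm)
    · intro n x hx y hxy
      cases n with
      | zero =>
        obtain ⟨g, hg, -⟩ := c₂ _ y ((cyc 1 x).1 hx) hxy
        exact bdry 0 x g hg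
      | succ n =>
        obtain ⟨g, -, hg, -⟩ := c₃ n _ y ((cyc (n + 2) x).1 hx) hxy
        exact bdry (n + 1) x g hg
    · intro y hy
      -- A cycle `y` of the injective complex gives the cycle `(0, y)` of the cone. That it is a
      -- boundary is surjectivity on homology.
      obtain ⟨g, hg, hg'⟩ := c₂ 0 y (map_zero _) ((map_zero _).trans hy.symm)
      obtain ⟨c, hc, rfl⟩ := lift 0 g hg
      exact ⟨c, hc, hg'⟩
    · intro n y hy
      obtain ⟨g, i, hg, hg'⟩ := c₃ n 0 y (map_zero _) ((map_zero _).trans hy.symm)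
      obtain ⟨c, hc, rfl⟩ := lift (n + 1) g hg
      exact ⟨c, hc, -i, (congrArg _ (map_neg ((e n).hom.app (op Set.univ)).hom i)).trans
        ((sub_eq_add_neg _ _).symm.trans hg')⟩
  exact ⟨P.isoRightDerivedObj (globalSections X) q ≪≫
    (asIso (HomologicalComplex.homologyMap ψ q)).symm⟩

end Main

end Coarse

/-- For a metric space `X` and an abelian group `A`, the presheaves `U ↦ CY_b^q(U, A)` are sheaves
on `X_ct` and form a flabby resolution of the constant sheaf `A_X`; the coarse sheaf cohomology of
`X` with values in `A_X` is isomorphic to `HY_b^q(X, A)` in every degree. -/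
theorem theoremA (X : Type u) [MetricSpace X] (A : Type u) [AddCommGroup A] :
    ∃ h : ∀ q, Presheaf.IsSheaf (Coarse.coarseTopology X) (Coarse.CYPresheaf X A q),
      Coarse.IsFlabbyResolution (G := fun q => ⟨Coarse.CYPresheaf X A q, h q⟩)
        (Coarse.augmentation (h 0)) (fun q => ObjectProperty.homMk (Coarse.CYPresheafD X A q)) ∧
      ∀ q, Nonempty (Coarse.coarseCohomology (Coarse.constSheaf X A) q ≅ Coarse.HY X A q) :=
  have hres := Coarse.isFlabbyResolution_CY (Coarse.isSheaf_CYPresheaf X A)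
  ⟨Coarse.isSheaf_CYPresheaf X A, hres, Coarse.nonempty_coarseCohomology_iso _ hres⟩
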